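/- Let $K$ be a field of characteristic $0$ (for instance $K=\mathbb C$) and let $r:\mathbb Z\to K$ satisfy $r(n)=r(1-n)$ for all $n\in\mathbb Z$. Let $\phi_n$ $(n\in\mathbb Z)$ be neutral fermions, $\phi_m\phi_n+\phi_n\phi_m=(-1)^m\delta_{m,-n}$, acting on the Fock space with basis $\phi_{n_1}\cdots\phi_{n_k}|0\rangle$ $(n_1>\cdots>n_k\ge 0,\ k\ge 0)$, where $\phi_m|0\rangle=0$ for $m<0$; let $\langle 0|$ be the linear functional on it with $\langle 0|\phi_m=0$ for $m>0$, $\langle 0|0\rangle=1$ and $\langle 0|\phi_0|0\rangle=0$. For odd $n,k>0$ put $$H_n=\tfrac12\sum_{j\in\mathbb Z}(-1)^{j+1}\phi_j\phi_{-j-n},\qquad B_k=\tfrac12\sum_{n\in\mathbb Z}(-1)^n\,r(n)r(n-1)\cdots r(n-k+1)\,\phi_n\phi_{k-n}$$ (the sums are finite on every vector), and, for formal variables $t=(t_1,t_3,t_5,\dots)$ and $t^*=(t_1^*,t_3^*,t_5^*,\dots)$, put $H(t)=\sum_{n\text{ odd}}t_nH_n$ and $B(t^*)=\sum_{n\text{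 odd}}t^*_nB_n$. The BKP tau function of hypergeometric type is the formal power series $$\tau_r(t,t^*)=\langle 0|e^{H(t)}e^{-B(t^*)}|0\rangle\in K[[t,t^*]].$$ Let $q_n(s)$ be the polynomials in $s=(s_1,s_3,s_5,\dots)$ defined by $\sum_{n\ge0}q_n(s)z^n=\exp\bigl(2\sum_{m\text{ odd}}s_mz^m\bigr)$, and put $Q_{(a,b)}=q_aq_b+2\sum_{i=1}^{b}(-1)^iq_{a+i}q_{b-i}$ for $a>b\ge0$. For a strict partition $\lambda=(n_1>\cdots>n_l>0)$ let $l(\lambda)=l$, let $r_\lambda=\prod_{i=1}^{l}r(1)r(2)\cdots r(n_i)$, and let $Q_\lambda(s)$ be the Schur $Q$-function, that is, the Pfaffian of the skew-symmetric matrix with entries $Q_{(n_i,n_j)}$ for $i<j$, where $n_{l+1}=0$ is appended to $\lambda$ if $l$ is odd. Then $$\tau_r(t,t^*)=1+\sum_{\lambda}2^{-l(\lambda)}\,r_\lambda\,Q_\lambda\!\left(\tfrac t2\right)Q_\lambda\!\left(\tfrac{t^*}2\right),$$ where the sum runs over all nonzero strict partitions $\lambda$; it is a convergent sum of formal power series,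 that is, only finitely many terms contribute to the coefficient of any given monomial. -/

import Mathlib

open scoped MvPowerSeries.WithPiTopology

noncomputable section

namespace NeutralFermion

variable (K : Type*) [Field K]

/-! ### Neutral fermions and their Fock space -/

/-- The span of the creation modes `e_0, e_1, e_2, …`. -/
abbrev Modes : Type _ := ℕ →₀ K

/-- The quadratic form on the creation modes: `e_0` has square `1/2`, the other modes have square
zero, and distinct modes are orthogonal. -/
def modeForm : QuadraticForm K (Modes K) :=
  (1 / 2 : K) • QuadraticMap.linMulLin (Finsupp.lapply 0) (Finsupp.lapply 0)

/-- The right Fock space, with basis `φ_{n_1} ⋯ φ_{n_k} |0⟩`, `n_1 > ⋯ > n_k ≥ 0`. It is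
realised as the algebra generated by the creation modes. -/
abbrev Fock : Type _ := CliffordAlgebra (modeForm K)

/-- The neutral fermions `φ_n`, `n ∈ ℤ`, as operators on the Fock space: for `n ≥ 0` multiplication
by the mode `e_n`, for `n < 0` the contraction with the mode `e_{-n}` times `(-1)^n`. -/
def phi : ℤ → Module.End K (Fock K)
  | Int.ofNat m => LinearMap.mulLeft K (CliffordAlgebra.ι (modeForm K) (Finsupp.single m 1))
  | Int.negSucc m => (-1 : K) ^ (m + 1) •
      CliffordAlgebra.contractLeft (Q := modeForm K) (Finsupp.lapply (m + 1))

/-- The right vacuum vector `|0⟩`. -/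
def vac : Fock K := 1

/-- The bilinear form comparing `modeForm` with the zero form. -/
def modeBilin : LinearMap.BilinForm K (Modes K) :=
  (-(1 / 2 : K)) • LinearMap.BilinForm.linMulLin (Finsupp.lapply 0) (Finsupp.lapply 0)

theorem modeBilin_toQuadraticMap :
    (modeBilin K).toQuadraticMap = (0 : QuadraticForm K (Modes K)) - modeForm K := by
  ext v
  simp [modeBilin, modeForm]

/-- The left vacuum vector `⟨0|`, as a linear functional on the Fock space: the scalar part, once
the Clifford algebra is identified as a vector space with the exterior algebra. -/
def covac : Fock K →ₗ[K] K :=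
  (ExteriorAlgebra.algebraMapInv (R := K) (M := Modes K)).toLinearMap ∘ₗ
    CliffordAlgebra.changeForm (modeBilin_toQuadraticMap K)

variable {K}

theorem phi_natCast (m : ℕ) (x : Fock K) :
    phi K (m : ℤ) x = CliffordAlgebra.ι (modeForm K) (Finsupp.single m 1) * x := rfl

theorem phi_neg (m : ℕ) (x : Fock K) :
    phi K (-((m + 1 : ℕ) : ℤ)) x = (-1 : K) ^ (m + 1) •
      CliffordAlgebra.contractLeft (Q := modeForm K) (Finsupp.lapply (m + 1)) x := rfl

/-- The canonical anticommutation relations `[φ_m, φ_n]_+ = (-1)^m δ_{m,-n}`. -/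
theorem phi_anticomm [CharZero K] (m n : ℤ) :
    phi K m * phi K n + phi K n * phi K m = if m = -n then (-1 : K) ^ m.natAbs • 1 else 0 := by
  have key : ∀ a b : ℕ, phi K (-((a + 1 : ℕ) : ℤ)) * phi K (b : ℤ)
      + phi K (b : ℤ) * phi K (-((a + 1 : ℕ) : ℤ)) =
      if b = a + 1 then (-1 : K) ^ (a + 1) • 1 else 0 := by
    intro a b
    ext1 x
    simp only [LinearMap.add_apply, Module.End.mul_apply, phi_natCast, phi_neg,
      CliffordAlgebra.contractLeft_ι_mul, Finsupp.lapply_apply, Finsupp.single_apply]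
    split_ifs with h
    · simp [smul_sub]
    · simp
  rcases m with a | a <;> rcases n with b | b
  · ext1 x
    change phi K (a : ℤ) (phi K (b : ℤ) x) + phi K (b : ℤ) (phi K (a : ℤ) x) = _
    simp only [phi_natCast, ← mul_assoc, ← add_mul]
    rw [CliffordAlgebra.ι_mul_ι_add_swap]
    have hpol : QuadraticMap.polar (modeForm K) (Finsupp.single a 1) (Finsupp.single b 1)
        = if a = 0 ∧ b = 0 then 1 else 0 := by
      simp only [QuadraticMap.polar, modeForm, smul_apply,
        QuadraticMap.linMulLin_apply, Finsupp.lapply_apply, Finsupp.add_apply,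
        Finsupp.single_apply, smul_eq_mul]
      by_cases ha : a = 0 <;> by_cases hb : b = 0 <;> simp [ha, hb]
      norm_num
    rw [hpol]
    by_cases h : a = 0 ∧ b = 0
    · obtain ⟨rfl, rfl⟩ := h
      simp
    · have h' : ¬ ((Int.ofNat a) = -(Int.ofNat b)) := by
        intro h'; apply h; simp only [Int.ofNat_eq_natCast] at h'; omega
      simp only [h, h', if_false, map_zero, zero_mul, LinearMap.zero_apply]
  · have := key b a
    rw [add_comm]
    refine this.trans ?_
    by_cases h : a = b + 1
    · subst h
      have h' : (Int.ofNat (b + 1)) = -(Int.negSucc b) := rfl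
      simp only [if_true, h']
      rfl
    · have h' : ¬ ((Int.ofNat a) = -(Int.negSucc b)) := by
        simp only [Int.ofNat_eq_natCast, Int.neg_negSucc]; omega
      rw [if_neg h, if_neg h']
  · refine (key a b).trans ?_
    by_cases h : b = a + 1
    · subst h
      have h' : (Int.negSucc a) = -(Int.ofNat (a + 1)) := rfl
      rw [if_pos rfl, if_pos h']
      rfl
    · have h' : ¬ ((Int.negSucc a) = -(Int.ofNat b)) := by
        simp only [Int.ofNat_eq_natCast]; omega
      rw [if_neg h, if_neg h']
  · have h' : ¬ ((Int.negSucc a) = -(Int.negSucc b)) := by omega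
    rw [if_neg h']
    ext1 x
    change phi K (-((a + 1 : ℕ) : ℤ)) (phi K (-((b + 1 : ℕ) : ℤ)) x)
      + phi K (-((b + 1 : ℕ) : ℤ)) (phi K (-((a + 1 : ℕ) : ℤ)) x) = 0
    simp only [phi_neg, map_smul]
    rw [CliffordAlgebra.contractLeft_comm, smul_neg, smul_neg, smul_comm, neg_add_cancel]

/-- `φ_m |0⟩ = 0` for `m < 0`. -/
theorem phi_vac {m : ℤ} (hm : m < 0) : phi K m (vac K) = 0 := by
  obtain ⟨a, rfl⟩ : ∃ a : ℕ, m = -((a + 1 : ℕ) : ℤ) := ⟨(-m - 1).toNat, by omega⟩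
  rw [phi_neg, vac, CliffordAlgebra.contractLeft_one, smul_zero]

/-- `⟨0| φ_m = 0` for `m > 0`. -/
theorem covac_phi {m : ℤ} (hm : 0 < m) (x : Fock K) : covac K (phi K m x) = 0 := by
  obtain ⟨a, rfl⟩ : ∃ a : ℕ, m = ((a + 1 : ℕ) : ℤ) := ⟨(m - 1).toNat, by omega⟩
  rw [phi_natCast, covac, LinearMap.comp_apply, CliffordAlgebra.changeForm_ι_mul]
  have : modeBilin K (Finsupp.single (a + 1) 1) = 0 := by
    ext; simp [modeBilin]
  rw [this]
  simp only [map_zero, LinearMap.zero_apply, sub_zero, AlgHom.toLinearMap_apply, map_mul]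
  have h2 : ExteriorAlgebra.algebraMapInv (CliffordAlgebra.ι (0 : QuadraticForm K (Modes K))
      (Finsupp.single (a + 1) 1)) = 0 := by
    simp [ExteriorAlgebra.algebraMapInv]
  rw [h2, zero_mul]

/-- `⟨0|0⟩ = 1`. -/
theorem covac_vac : covac K (vac K) = 1 := by
  simp [covac, vac]

/-- `⟨0|φ_0|0⟩ = 0`. -/
theorem covac_phi_zero_vac : covac K (phi K 0 (vac K)) = 0 := by
  have h : phi K 0 (vac K) = CliffordAlgebra.ι (modeForm K) (Finsupp.single 0 1) := by
    simpa [vac] using phi_natCast (K := K) 0 (vac K)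
  rw [h, covac, LinearMap.comp_apply, CliffordAlgebra.changeForm_ι]
  simp [ExteriorAlgebra.algebraMapInv]

/-- The Fock space is spanned by the vectors `φ_{n_1} ⋯ φ_{n_k} |0⟩` with `n_i ≥ 0`. -/
theorem span_phi_vac : Submodule.span K (Set.range fun l : List ℕ =>
    (l.map fun n => phi K (n : ℤ)).prod (vac K)) = ⊤ := by
  rw [eq_top_iff]
  rintro x -
  induction x using CliffordAlgebra.left_induction with
  | algebraMap c =>
    rw [Algebra.algebraMap_eq_smul_one]
    exact Submodule.smul_mem _ _ (Submodule.subset_span ⟨[], rfl⟩)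
  | add x y hx hy => exact Submodule.add_mem _ hx hy
  | ι_mul x v hx =>
    induction v using Finsupp.induction_linear with
    | zero => simp
    | add f g hf hg => rw [map_add, add_mul]; exact Submodule.add_mem _ hf hg
    | single n c =>
      have h : Finsupp.single n c = c • Finsupp.single n (1 : K) := by simp
      rw [h, map_smul, smul_mul_assoc]
      refine Submodule.smul_mem _ _ ?_
      rw [← phi_natCast]
      induction hx using Submodule.span_induction with
      | mem y hy =>
        obtain ⟨l, rfl⟩ := hy
        exact Submodule.subset_span ⟨n :: l, by simp⟩
      | zero => simp
      | add y z _ _ hy hz => rw [map_add]; exact Submodule.add_mem _ hy hz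
      | smul c y _ hy => rw [map_smul]; exact Submodule.smul_mem _ _ hy

/-- Every vector is annihilated by all `φ_m` with `m` sufficiently negative. -/
theorem exists_phi_eq_zero (x : Fock K) : ∃ N : ℤ, ∀ m < N, phi K m x = 0 := by
  suffices h : ∃ N : ℕ, ∀ m ≥ N, CliffordAlgebra.contractLeft (Q := modeForm K)
      (Finsupp.lapply (m + 1)) x = 0 by
    obtain ⟨N, hN⟩ := h
    refine ⟨-(N : ℤ), fun m hm => ?_⟩
    obtain ⟨a, rfl⟩ : ∃ a : ℕ, m = -((a + 1 : ℕ) : ℤ) := ⟨(-m - 1).toNat, by omega⟩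
    rw [phi_neg, hN a (by omega), smul_zero]
  induction x using CliffordAlgebra.left_induction with
  | algebraMap c => exact ⟨0, fun m _ => CliffordAlgebra.contractLeft_algebraMap _ _ _⟩
  | add x y hx hy =>
    obtain ⟨N, hN⟩ := hx
    obtain ⟨M, hM⟩ := hy
    exact ⟨max N M, fun m hm => by
      rw [map_add, hN m (le_trans (le_max_left _ _) hm), hM m (le_trans (le_max_right _ _) hm),
        add_zero]⟩
  | ι_mul x v hx =>
    obtain ⟨N, hN⟩ := hx
    refine ⟨max N (v.support.sup id), fun m hm => ?_⟩
    have hv : v (m + 1) = 0 := by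
      by_contra h
      have h1 : m + 1 ≤ v.support.sup id :=
        Finset.le_sup (f := id) (Finsupp.mem_support_iff.mpr h)
      have h2 := le_trans (le_max_right N (v.support.sup id)) hm
      omega
    rw [CliffordAlgebra.contractLeft_ι_mul, hN m (le_trans (le_max_left _ _) hm)]
    simp [hv]

/-- For `k ≠ 0` the bilinear sums `∑_n c_n φ_n φ_{k-n}` are finite on every vector. -/
theorem finite_support_phi_phi [CharZero K] {k : ℤ} (hk : k ≠ 0) (c : ℤ → K) (x : Fock K) :
    (Function.support fun n : ℤ => (c n • (phi K n * phi K (k - n))) x).Finite := by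
  obtain ⟨N, hN⟩ := exists_phi_eq_zero x
  refine (Set.finite_Icc N (k - N)).subset fun n hn => ?_
  rw [Function.mem_support] at hn
  by_contra h
  apply hn
  rw [Set.mem_Icc, not_and_or, not_le, not_le] at h
  rw [LinearMap.smul_apply, Module.End.mul_apply]
  rcases h with h | h
  · have := congrArg (fun f => f x) (phi_anticomm (K := K) n (k - n))
    simp only [LinearMap.add_apply, Module.End.mul_apply, hN n h, map_zero, add_zero] at this
    rw [this, if_neg (by omega)]
    simp
  · rw [hN _ (by omega), map_zero, smul_zero]

/-- The pointwise finite sum of a family of operators. -/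
def pointwiseSum (A : ℤ → Module.End K (Fock K))
    (hA : ∀ x, (Function.support fun n => A n x).Finite) : Module.End K (Fock K) where
  toFun x := ∑ᶠ n, A n x
  map_add' x y := by
    simp only [map_add]
    exact finsum_add_distrib (hA x) (hA y)
  map_smul' c x := by
    simp only [map_smul, RingHom.id_apply]
    exact (smul_finsum' c (hA x)).symm

/-! ### The Hamiltonians and the additional symmetries -/

/-- The odd positive integers, which index the times `t_1, t_3, t_5, …`. -/
abbrev OddIndex : Type := {n : ℕ // Odd n}

theorem OddIndex.ne_zero (n : OddIndex) : ((n : ℕ) : ℤ) ≠ 0 := by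
  have := n.2.pos
  omega

variable (K) in
/-- `H_n = (1/2) ∑_{k ∈ ℤ} (-1)^{k+1} φ_k φ_{-k-n}`, for odd `n > 0`. -/
def hamiltonian [CharZero K] (n : OddIndex) : Module.End K (Fock K) :=
  pointwiseSum (fun k => ((1 / 2 : K) * (-1) ^ (k + 1)) • (phi K k * phi K (-(n : ℕ) - k)))
    (finite_support_phi_phi (neg_ne_zero.mpr n.ne_zero) _)

/-- `B_k = (1/2) ∑_{n ∈ ℤ} (-1)^n φ_n φ_{k-n} r(n) r(n-1) ⋯ r(n-k+1)`, for odd `k > 0`. -/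
def symmetryOp [CharZero K] (r : ℤ → K) (k : OddIndex) : Module.End K (Fock K) :=
  pointwiseSum (fun n => ((1 / 2 : K) * (-1) ^ n * ∏ i ∈ Finset.range k, r (n - i)) •
      (phi K n * phi K ((k : ℕ) - n)))
    (finite_support_phi_phi k.ne_zero _)

/-! ### Formal power series in the times -/

/-- The formal variables: `Sum.inl n` stands for `t_n` and `Sum.inr n` for `t*_n`. -/
abbrev Times : Type := OddIndex ⊕ OddIndex

/-- The formal series `∑_i A_i x_i`, linear in the variables `x_i`. In the coefficient at a given
exponent `d` only the variables that occur in `d` contribute. -/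
def linearSeries {σ E : Type*} [Semiring E] (A : σ → E) : MvPowerSeries σ E := fun d =>
  ∑ i ∈ d.support, MvPowerSeries.coeff d (MvPowerSeries.monomial (Finsupp.single i 1) (A i))

variable (K) in
/-- The exponential `∑_j A^j / j!` of a formal series without constant term, possibly with
noncommuting coefficients. The coefficient at `d` receives contributions only from `j ≤ |d|`. -/
def formalExp {σ E : Type*} [Ring E] [Algebra K E] (A : MvPowerSeries σ E) : MvPowerSeries σ E :=
  fun d => ∑ j ∈ Finset.range (d.degree + 1),
    ((Nat.factorial j : K)⁻¹) • MvPowerSeries.coeff d (A ^ j)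

variable (K) in
/-- `H(t) = ∑_{n odd} t_n H_n`. -/
def hamiltonianSeries [CharZero K] : MvPowerSeries Times (Module.End K (Fock K)) :=
  linearSeries (Sum.elim (fun n => hamiltonian K n) fun _ => 0)

/-- `B(t*) = ∑_{n odd} t*_n B_n`. -/
def symmetrySeries [CharZero K] (r : ℤ → K) : MvPowerSeries Times (Module.End K (Fock K)) :=
  linearSeries (Sum.elim (fun _ => 0) fun n => symmetryOp r n)

/-- The tau function `τ_r(t,t*) = ⟨0| e^{H(t)} e^{-B(t*)} |0⟩`, a formal power series in the
times. -/
def tau [CharZero K] (r : ℤ → K) : MvPowerSeries Times K := fun d =>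
  covac K (MvPowerSeries.coeff d
    (formalExp K (hamiltonianSeries K) * formalExp K (-symmetrySeries r)) (vac K))

end NeutralFermion

/-! ### Strict partitions and Schur Q-functions -/

namespace SchurQ

open NeutralFermion (OddIndex)

/-- Strict partitions `n_1 > n_2 > ⋯ > n_l > 0`. -/
structure StrictPartition where
  /-- The parts, in decreasing order. -/
  parts : List ℕ
  decreasing : parts.Pairwise (· > ·)
  pos : ∀ n ∈ parts, 0 < n

/-- The length `l(λ)`. -/
def StrictPartition.length (p : StrictPartition) : ℕ := p.parts.length

/-- `r_λ = ∏_i r(1) r(2) ⋯ r(n_i)`. -/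
def StrictPartition.rProd {K : Type*} [Field K] (r : ℤ → K) (p : StrictPartition) : K :=
  (p.parts.map fun n => ∏ j ∈ Finset.Icc 1 n, r j).prod

variable (K : Type*) [Field K]

/-- The generating function `∑_n q_n(s) z^n = exp (2 ∑_{m odd} s_m z^m)`, as a power series
in `z` over the polynomials in `s_1, s_3, s_5, …`. -/
def qSeries : PowerSeries (MvPolynomial OddIndex K) :=
  NeutralFermion.formalExp K (σ := Unit) (E := MvPolynomial OddIndex K)
    (PowerSeries.mk fun m => if h : Odd m then 2 * MvPolynomial.X ⟨m, h⟩ else 0)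

/-- The polynomial `q_n(s)`. -/
def q (n : ℕ) : MvPolynomial OddIndex K := PowerSeries.coeff n (qSeries K)

/-- `Q_{(a,b)} = q_a q_b + 2 ∑_{i=1}^{b} (-1)^i q_{a+i} q_{b-i}`, for `a > b ≥ 0`. -/
def Q2 (a b : ℕ) : MvPolynomial OddIndex K :=
  q K a * q K b + 2 * ∑ i ∈ Finset.Icc 1 b, (-1) ^ i * (q K (a + i) * q K (b - i))

/-- The Pfaffian of the skew-symmetric matrix whose entries above the diagonal are `a x_i x_j`,
`i < j`, for a list `x_0, x_1, …` of even length, by expansion along the first row. -/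
def pfaffian {ι R : Type*} [CommRing R] (a : ι → ι → R) : List ι → R
  | [] => 1
  | x :: xs => ∑ i : Fin xs.length, (-1) ^ (i : ℕ) * a x xs[i] * pfaffian a (xs.eraseIdx i)
termination_by l => l.length
decreasing_by
  have := i.2
  simp only [List.length_eraseIdx, List.length_cons]
  split_ifs
  omega

/-- Schur's Q-function `Q_λ(s)`, as a polynomial in the times `s_1, s_3, s_5, …`: the Pfaffian of
the `Q_{(n_i,n_j)}`, where a part `0` is appended if the length of `λ` is odd. The times are related
to the symmetric functions of variables `x_i` by `s_m = (1/m) ∑_i x_i^m`. -/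
def schurQ (p : StrictPartition) : MvPolynomial OddIndex K :=
  pfaffian (Q2 K) (if Even p.length then p.parts else p.parts ++ [0])

open NeutralFermion (Times)

/-- `Q_λ(t/2)`, as a formal power series in `t` and `t*`. -/
def schurQHalf (p : StrictPartition) : MvPowerSeries Times K :=
  MvPolynomial.aeval (fun n => (1 / 2 : K) • MvPowerSeries.X (Sum.inl n)) (schurQ K p)

/-- `Q_λ(t*/2)`, as a formal power series in `t` and `t*`. -/
def schurQHalfStar (p : StrictPartition) : MvPowerSeries Times K :=
  MvPolynomial.aeval (fun n => (1 / 2 : K) • MvPowerSeries.X (Sum.inr n)) (schurQ K p)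

/-- The summand `2^{-l(λ)} r_λ Q_λ(t/2) Q_λ(t*/2)`. -/
def tauTerm (r : ℤ → K) (p : StrictPartition) : MvPowerSeries Times K :=
  ((2 : K)⁻¹ ^ p.length * p.rProd r) • (schurQHalf K p * schurQHalfStar K p)

end SchurQ

end

/-! Insert a resolution of the identity between the two exponentials. The decreasing words `φ_{n_1}
⋯ φ_{n_k}|0⟩` form an orthogonal basis for the pairing with `⟨0| φ_{n_k}^* ⋯ φ_{n_1}^*`, where
`φ_n^* = (-1)^n φ_{-n}`; the norms are `1`, or `1/2` if the mode `0` occurs. So `τ_r` is a sum over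
decreasing words of a factor in `t`, a factor in `t*` and an inverse norm.

The dependence on `r` is split off by the diagonal map `G` with `e_n ↦ r(1) ⋯ r(n) e_n`. The
symmetry `r(n) = r(1-n)` gives `B_k(r) G = G B_k(1)` (`symmetryOp_gauge`), hence `e^{-B}|0⟩` is `G`
applied to the same vector for `r = 1`. This relation needs no inverse of `G`, so `r` may vanish.

For `r = 1` both factors are found by one argument (`evolved_word`). The commutator `[H_k, φ_n] =
φ_{n-k}` and `H_k|0⟩ = 0` express each coefficient of `⟨0|e^{H(t)} φ_{n_1} ⋯ φ_{n_l}|0⟩` of positive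
degree through coefficients of lower degree; the constant term is a Pfaffian of contractions by
Wick's theorem. The Pfaffian of the evolved contractions, built from `q_j(t/2)`, satisfies the same
recursion because `∂_k q_j(t/2) = q_{j-k}(t/2)`, and it has the same constant term. The operators
`φ_n^*` with reversed multiplication satisfy the same relations with `-B_k(1)` in place of `H_k`,
which gives the factor in `t*`.

The evolved contraction of modes `a, b ≥ 0` is `Q_{(a,b)}(t/2)/2`. Words of odd length contribute
zero; those of even length are the strict partitions, with a `0` appended if the length is odd. The
halves from the two Pfaffians and the inverse norm combine to `2^{-l(λ)}`. -/

noncomputable section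

namespace SchurQ

/-! ### Alternating expansions and shifts along a list -/

section Expansion

variable {ι R M : Type*} [CommRing R] [AddCommGroup M] [Module R M]

/-- The signed expansion `∑_i (-1)^i b(x_i) F(x_0, …, x̂_i, …)` along the letters of a list. -/
def rowExp (b : ι → R) : (List ι → M) → List ι → M
  | _, [] => 0
  | F, y :: ys => b y • F ys - rowExp b (fun zs => F (y :: zs)) ys

/-- The sum of the values of `F` at the lists obtained by replacing one letter `x` by `s x`. -/
def shiftSum (s : ι → ι) : (List ι → M) → List ι → M
  | _, [] => 0
  | F, y :: ys => F (s y :: ys) + shiftSum s (fun zs => F (y :: zs)) ys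

theorem rowExp_congr {b b' : ι → R} {F G : List ι → M} {l : List ι} (hb : ∀ x ∈ l, b x = b' x)
    (h : ∀ m : List ι, m.length + 1 = l.length → F m = G m) : rowExp b F l = rowExp b' G l := by
  induction l generalizing F G with
  | nil => rfl
  | cons y ys ih =>
    simp only [rowExp]
    rw [h ys rfl, hb y (by simp),
      ih (fun x hx => hb x (by simp [hx])) fun m hm => h (y :: m) (by simpa using hm)]

theorem rowExp_congr_fun {b : ι → R} {F G : List ι → M} {l : List ι}
    (h : ∀ m : List ι, m.length + 1 = l.length → F m = G m) : rowExp b F l = rowExp b G l :=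
  rowExp_congr (fun _ _ => rfl) h

theorem rowExp_zero_left {b : ι → R} {F : List ι → M} {l : List ι} (hb : ∀ x ∈ l, b x = 0) :
    rowExp b F l = 0 := by
  induction l generalizing F with
  | nil => rfl
  | cons y ys ih =>
    simp only [rowExp]
    rw [hb y (by simp), ih (fun x hx => hb x (by simp [hx])), zero_smul, sub_zero]

theorem rowExp_zero_right (b : ι → R) (l : List ι) : rowExp b (fun _ => (0 : M)) l = 0 := by
  induction l with
  | nil => rfl
  | cons y ys ih => simp [rowExp, ih]

theorem rowExp_add_left (b b' : ι → R) (F : List ι → M) (l : List ι) :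
    rowExp (fun x => b x + b' x) F l = rowExp b F l + rowExp b' F l := by
  induction l generalizing F with
  | nil => simp [rowExp]
  | cons y ys ih => simp only [rowExp, ih, add_smul]; abel

theorem rowExp_add_right (b : ι → R) (F G : List ι → M) (l : List ι) :
    rowExp b (fun x => F x + G x) l = rowExp b F l + rowExp b G l := by
  induction l generalizing F G with
  | nil => simp [rowExp]
  | cons y ys ih => simp only [rowExp, ih, smul_add]; abel

theorem rowExp_smul_left (c : R) (b : ι → R) (F : List ι → M) (l : List ι) :
    rowExp (fun x => c * b x) F l = c • rowExp b F l := by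
  induction l generalizing F with
  | nil => simp [rowExp]
  | cons y ys ih => simp only [rowExp, ih, mul_smul, smul_sub]

theorem rowExp_smul_right (c : R) (b : ι → R) (F : List ι → M) (l : List ι) :
    rowExp b (fun x => c • F x) l = c • rowExp b F l := by
  induction l generalizing F with
  | nil => simp [rowExp]
  | cons y ys ih => simp only [rowExp, ih, smul_sub, smul_comm c]

theorem map_rowExp {N : Type*} [AddCommGroup N] [Module R N] (f : M →ₗ[R] N) (b : ι → R)
    (F : List ι → M) (l : List ι) : f (rowExp b F l) = rowExp b (fun x => f (F x)) l := by
  induction l generalizing F with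
  | nil => simp [rowExp]
  | cons y ys ih => simp only [rowExp, ih, map_sub, map_smul]

theorem ringHom_rowExp {S : Type*} [CommRing S] (f : R →+* S) (b : ι → R)
    (F : List ι → R) (l : List ι) :
    f (rowExp b F l) = rowExp (fun x => f (b x)) (fun x => f (F x)) l := by
  induction l generalizing F with
  | nil => simp [rowExp]
  | cons y ys ih => simp only [rowExp, ih, map_sub, smul_eq_mul, map_mul]

theorem derivation_rowExp {S : Type*} [CommRing S] [Algebra S R] (D : Derivation S R R)
    (b : ι → R) (F : List ι → R) (l : List ι) :
    D (rowExp b F l) = rowExp (fun x => D (b x)) F l + rowExp b (fun x => D (F x)) l := by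
  induction l generalizing F with
  | nil => simp [rowExp]
  | cons y ys ih =>
    simp only [rowExp, ih, map_sub, smul_eq_mul, Derivation.leibniz]
    ring

theorem shiftSum_sub (s : ι → ι) (F G : List ι → M) (l : List ι) :
    shiftSum s (fun x => F x - G x) l = shiftSum s F l - shiftSum s G l := by
  induction l generalizing F G with
  | nil => simp [shiftSum]
  | cons y ys ih => simp only [shiftSum, ih]; abel

theorem shiftSum_map {N : Type*} [AddCommGroup N] (f : M →+ N) (s : ι → ι)
    (F : List ι → M) (l : List ι) : f (shiftSum s F l) = shiftSum s (fun x => f (F x)) l := by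
  induction l generalizing F with
  | nil => simp [shiftSum]
  | cons y ys ih => simp only [shiftSum, ih, map_add]

theorem shiftSum_congr {s : ι → ι} {F G : List ι → M} (l : List ι)
    (h : ∀ m : List ι, m.length = l.length → F m = G m) : shiftSum s F l = shiftSum s G l := by
  induction l generalizing F G with
  | nil => rfl
  | cons y ys ih =>
    simp only [shiftSum]
    rw [h (s y :: ys) rfl, ih fun m hm => h (y :: m) (by simpa using hm)]

/-- The shifted letter is either the one that the expansion removes or one of those that remain. -/
theorem shiftSum_rowExp (s : ι → ι) (b : ι → R) (F : List ι → M) (l : List ι) :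
    shiftSum s (rowExp b F) l = rowExp (fun x => b (s x)) F l + rowExp b (shiftSum s F) l := by
  induction l generalizing F with
  | nil => simp [shiftSum, rowExp]
  | cons y ys ih =>
    have h : shiftSum s (fun zs => b y • F zs) ys = b y • shiftSum s F ys :=
      (shiftSum_map (DistribSMul.toAddMonoidHom M (b y)) s F ys).symm
    simp only [shiftSum, rowExp, shiftSum_sub, h, rowExp_add_right]
    rw [ih]
    abel

end Expansion

/-! ### Pfaffians indexed by lists -/

section Pfaffian

variable {ι R : Type*} [CommRing R]

theorem sum_eraseIdx_eq_rowExp (b : ι → R) (F : List ι → R) (l : List ι) :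
    ∑ i : Fin l.length, (-1) ^ (i : ℕ) * b l[i] * F (l.eraseIdx i) = rowExp b F l := by
  induction l generalizing F with
  | nil => simp [rowExp]
  | cons y ys ih =>
    simp only [rowExp, ← ih, List.length_cons, Fin.sum_univ_succ]
    simp [pow_succ, sub_eq_add_neg, Finset.sum_neg_distrib]

theorem pfaffian_nil (a : ι → ι → R) : pfaffian a [] = 1 := by
  rw [pfaffian]

theorem pfaffian_cons (a : ι → ι → R) (x : ι) (xs : List ι) :
    pfaffian a (x :: xs) = rowExp (a x) (pfaffian a) xs := by
  rw [pfaffian, sum_eraseIdx_eq_rowExp]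

theorem pfaffian_eq_zero_of_odd (a : ι → ι → R) (l : List ι) (hl : Odd l.length) :
    pfaffian a l = 0 := by
  induction h : l.length using Nat.strong_induction_on generalizing l with
  | _ n ih =>
    cases l with
    | nil => simp at hl
    | cons x xs =>
      rw [pfaffian_cons, ← rowExp_zero_right (a x) xs]
      refine rowExp_congr_fun fun m hm => ih m.length ?_ m ?_ rfl
      · simp only [List.length_cons] at h; omega
      · rw [List.length_cons, ← hm, Nat.odd_iff] at hl
        rw [Nat.odd_iff]; omega

theorem ringHom_pfaffian {S : Type*} [CommRing S] (f : R →+* S) (a : ι → ι → R) (l : List ι) :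
    f (pfaffian a l) = pfaffian (fun x y => f (a x y)) l := by
  induction h : l.length using Nat.strong_induction_on generalizing l with
  | _ n ih =>
    cases l with
    | nil => simp [pfaffian_nil]
    | cons x xs =>
      rw [pfaffian_cons, pfaffian_cons, ringHom_rowExp]
      refine rowExp_congr_fun fun m hm => ih m.length ?_ m rfl
      simp only [List.length_cons] at h; omega

theorem pfaffian_smul (c : R) (a : ι → ι → R) (n : ℕ) (l : List ι) (hl : l.length = 2 * n) :
    pfaffian (fun x y => c * a x y) l = c ^ n * pfaffian a l := by
  induction n generalizing l with
  | zero =>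
    cases l with
    | nil => simp [pfaffian_nil]
    | cons x xs => simp at hl
  | succ n ih =>
    cases l with
    | nil => simp at hl
    | cons x xs =>
      rw [pfaffian_cons, pfaffian_cons, rowExp_smul_left,
        rowExp_congr_fun (G := fun l => c ^ n • pfaffian a l), rowExp_smul_right]
      · simp only [smul_eq_mul]; ring
      · intro m hm
        exact ih m (by simp only [List.length_cons] at hl; omega)

/-- If a derivation acts on the entries by shifting the indices, it acts so on the Pfaffian. -/
theorem derivation_pfaffian {S : Type*} [CommRing S] [Algebra S R] (D : Derivation S R R)
    (s : ι → ι) (c : R) (a : ι → ι → R)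
    (ha : ∀ x y, D (a x y) = c * (a (s x) y + a x (s y))) (l : List ι) :
    D (pfaffian a l) = c * shiftSum s (pfaffian a) l := by
  induction h : l.length using Nat.strong_induction_on generalizing l with
  | _ n ih =>
    cases l with
    | nil => simp [pfaffian_nil, shiftSum]
    | cons x xs =>
      have h1 : (fun zs => pfaffian a (x :: zs)) = rowExp (a x) (pfaffian a) :=
        funext fun zs => pfaffian_cons a x zs
      rw [pfaffian_cons, derivation_rowExp, shiftSum, pfaffian_cons, h1, shiftSum_rowExp,
        rowExp_congr_fun (F := fun l => D (pfaffian a l))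
          (G := fun l => c • shiftSum s (pfaffian a) l), rowExp_smul_right]
      · simp only [ha]
        rw [rowExp_smul_left, rowExp_add_left]
        simp only [smul_eq_mul]; ring
      · intro m hm
        exact ih m.length (by simp only [List.length_cons] at h; omega) m rfl

end Pfaffian

end SchurQ

namespace SchurQ

/-! ### Wick's theorem for neutral fermions -/

section Wick

variable (K : Type*) [Field K]

/-- The contraction `⟨0|φ_a φ_b|0⟩` of two neutral fermions. -/
def contraction (a b : ℤ) : K :=
  if a = -b then (if a < 0 then (-1) ^ a.natAbs else if a = 0 then 1 / 2 else 0) else 0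

variable {K}
variable {A : Type*} [Ring A] [Algebra K A]

/-- The product of a family of operators along a word. -/
def word {ι A : Type*} [Monoid A] (ψ : ι → A) (l : List ι) : A := (l.map ψ).prod

theorem word_nil {ι A : Type*} [Monoid A] (ψ : ι → A) : word ψ [] = 1 := rfl

theorem word_cons {ι A : Type*} [Monoid A] (ψ : ι → A) (x : ι) (l : List ι) :
    word ψ (x :: l) = ψ x * word ψ l := by simp [word]

variable (K) in
/-- The canonical anticommutation relations of the neutral fermions. -/
def IsNeutral (ψ : ℤ → A) : Prop :=
  ∀ m n : ℤ, ψ m * ψ n + ψ n * ψ m = (if m = -n then (-1 : K) ^ m.natAbs else 0) • (1 : A)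

/-- Carrying `ψ a` through the word to its right end, each exchange costs a sign and leaves a scalar
anticommutator in place of the letter passed. -/
theorem IsNeutral.mul_word {ψ : ℤ → A} (hψ : IsNeutral K ψ) (a : ℤ) (l : List ℤ) :
    ψ a * word ψ l =
      rowExp (fun b => if a = -b then (-1 : K) ^ a.natAbs else 0) (word ψ) l +
        (-1 : K) ^ l.length • (word ψ l * ψ a) := by
  induction l with
  | nil => simp [rowExp, word_nil]
  | cons y ys ih =>
    have h : (fun zs => word ψ (y :: zs)) = fun zs => LinearMap.mulLeft K (ψ y) (word ψ zs) :=
      funext fun zs => word_cons ψ y zs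
    rw [word_cons, ← mul_assoc, eq_sub_of_add_eq (hψ a y), sub_mul, mul_assoc, ih, rowExp, h,
      ← map_rowExp, LinearMap.mulLeft_apply]
    simp only [smul_mul_assoc, one_mul, mul_add, mul_smul_comm, List.length_cons, pow_succ,
      mul_neg, mul_one, neg_smul, mul_assoc]
    abel

/-- **Wick's theorem** for a vacuum functional of the neutral fermions. -/
theorem IsNeutral.wick [CharZero K] {ψ : ℤ → A} (hψ : IsNeutral K ψ) (ω : A →ₗ[K] K)
    (hone : ω 1 = 1) (hzero : ω (ψ 0) = 0)
    (hpos : ∀ (m : ℤ) (x : A), 0 < m → ω (ψ m * x) = 0)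
    (hneg : ∀ (m : ℤ) (x : A), m < 0 → ω (x * ψ m) = 0)
    (hcomm : ∀ l : List ℤ, ω (word ψ l * ψ 0) = ω (ψ 0 * word ψ l)) (l : List ℤ) :
    ω (word ψ l) = pfaffian (contraction K) l := by
  induction hn : l.length using Nat.strong_induction_on generalizing l with
  | _ n ih =>
    -- A nonzero leading mode is easy: a negative one is carried to the right end, where it
    -- vanishes, and a positive one vanishes at once, as do its contractions.
    have hne : ∀ (a : ℤ) (as : List ℤ), a ≠ 0 → as.length + 1 = n →
        ω (word ψ (a :: as)) = pfaffian (contraction K) (a :: as) := by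
      intro a as ha has
      rw [pfaffian_cons]
      rcases ha.lt_or_gt with h | h
      · rw [word_cons, hψ.mul_word, map_add, map_smul, hneg _ _ h, smul_zero, add_zero,
          map_rowExp]
        refine rowExp_congr (fun b _ => ?_) fun m hm => ih m.length (by omega) m rfl
        simp [contraction, h]
      · rw [word_cons, hpos _ _ h, rowExp_zero_left]
        intro b _
        simp [contraction, h.not_gt, h.ne']
    cases l with
    | nil => simp [word_nil, pfaffian_nil, hone]
    | cons a as =>
      have has : as.length + 1 = n := by simpa using hn
      rcases eq_or_ne a 0 with rfl | ha
      -- The mode `0` kills neither vacuum. If the rest has even length, the whole word is odd and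
      -- must have value zero: either `ψ 0 ^ 2 = 1/2` shortens it, or `ψ 0` is exchanged with a
      -- nonzero letter, which reduces to `hne`.
      · rcases Nat.even_or_odd as.length with he | ho
        · rw [pfaffian_eq_zero_of_odd _ _ (by simpa using he.add_one)]
          cases as with
          | nil => simpa [word_cons, word_nil] using hzero
          | cons b bs =>
            rcases eq_or_ne b 0 with rfl | hb
            · have h00 : ψ 0 * ψ 0 = (1 / 2 : K) • (1 : A) := by
                have h := hψ 0 0
                rw [← two_smul K] at h
                simp only [neg_zero, if_true, Int.natAbs_zero, pow_zero, one_smul] at h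
                rw [← h, smul_smul]
                norm_num
              rw [word_cons, word_cons, ← mul_assoc, h00, smul_mul_assoc, one_mul, map_smul,
                ih bs.length (by simp only [List.length_cons] at has; omega) bs rfl,
                pfaffian_eq_zero_of_odd, smul_zero]
              rw [List.length_cons, Nat.even_iff] at he
              rw [Nat.odd_iff]; omega
            · have h := hψ 0 b
              rw [if_neg (by omega), zero_smul] at h
              rw [word_cons, word_cons, ← mul_assoc, eq_neg_of_add_eq_zero_left h, neg_mul,
                mul_assoc, ← word_cons ψ 0, ← word_cons ψ b, map_neg,
                hne b _ hb (by simpa using has), pfaffian_eq_zero_of_odd, neg_zero]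
              simpa using he.add_one
        -- If the rest has odd length, `ψ 0` arrives at the right end with sign `-1` and `hcomm`
        -- returns it to the front. So twice the value is the row expansion; this halves the
        -- anticommutator and explains the contraction `1/2` of `φ_0` with itself.
        · have h : ω (ψ 0 * word ψ as) =
              rowExp (fun b => if (0 : ℤ) = -b then (-1 : K) ^ (0 : ℤ).natAbs else 0)
                (fun l => ω (word ψ l)) as - ω (ψ 0 * word ψ as) := by
            conv_lhs => rw [hψ.mul_word, map_add, map_smul, hcomm, ho.neg_one_pow, map_rowExp]
            simp [sub_eq_add_neg]
          have h2 : ω (ψ 0 * word ψ as) = (1 / 2 : K) •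
              rowExp (fun b => if (0 : ℤ) = -b then (-1 : K) ^ (0 : ℤ).natAbs else 0)
                (fun l => ω (word ψ l)) as := by
            rw [smul_eq_mul]
            linear_combination (1 / 2 : K) * h
          rw [word_cons, h2, pfaffian_cons, ← rowExp_smul_left]
          refine rowExp_congr (fun b _ => ?_) fun m hm => ih m.length (by omega) m rfl
          simp [contraction]
      · exact hne a as ha has

/-- The commutator with `h` is a derivation, so it acts on one letter at a time. -/
theorem mul_word_of_commutator {ψ : ℤ → A} {h : A} {c : K} {k : ℤ}
    (hc : ∀ n, h * ψ n = ψ n * h + c • ψ (n - k)) (l : List ℤ) :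
    h * word ψ l = word ψ l * h + c • shiftSum (fun n => n - k) (word ψ) l := by
  induction l with
  | nil => simp [word_nil, shiftSum]
  | cons y ys ih =>
    have h' : (fun zs => word ψ (y :: zs)) = fun zs => AddMonoidHom.mulLeft (ψ y) (word ψ zs) :=
      funext fun zs => word_cons ψ y zs
    rw [word_cons, ← mul_assoc, hc, add_mul, mul_assoc, ih, shiftSum, word_cons, h',
      ← shiftSum_map, AddMonoidHom.coe_mulLeft]
    simp only [mul_add, smul_add, mul_smul_comm, smul_mul_assoc, mul_assoc]
    abel

end Wick

/-! ### Evolution of expectation values in the times -/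

section Evolution

variable {K : Type*} [Field K] {σ : Type*}

/-- Euler's identity: `∑ x_i ∂_i` multiplies the coefficient at `d` by `|d|`. In characteristic zero
it recovers a series from its constant term and its partial derivatives. -/
theorem natCast_degree_mul_coeff (f : MvPowerSeries σ K) (d : σ →₀ ℕ) :
    (d.degree : K) * MvPowerSeries.coeff d f = ∑ i ∈ d.support,
      MvPowerSeries.coeff (d - Finsupp.single i 1) (MvPowerSeries.pderiv K i f) := by
  rw [Finsupp.degree_apply, Nat.cast_sum, Finset.sum_mul]
  refine Finset.sum_congr rfl fun i hi => ?_
  have h1 : Finsupp.single i 1 ≤ d := by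
    rw [Finsupp.single_le_iff]
    exact Nat.one_le_iff_ne_zero.mpr (Finsupp.mem_support_iff.mp hi)
  have h2 : (((d - Finsupp.single i 1 : σ →₀ ℕ) i : ℕ) : K) + 1 = d i := by
    have := Finsupp.mem_support_iff.mp hi
    have h3 : d i - 1 + 1 = d i := by omega
    rw [Finsupp.tsub_apply, Finsupp.single_eq_same, ← Nat.cast_add_one, h3]
  rw [MvPowerSeries.coeff_pderiv, tsub_add_cancel_of_le h1, h2, mul_comm]

/-- The weights of the contractions `⟨0|φ_{-m} φ_m|0⟩`. -/
def contractionWeight (K : Type*) [Field K] (m : ℕ) : K := if m = 0 then 1 / 2 else (-1) ^ m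

/-- The contraction of two evolved neutral fermions `∑_j p_j φ_{a-j}` and `∑_j p_j φ_{b-j}`. -/
def evolvedContraction {R : Type*} [CommRing R] [Algebra K R] (p : ℤ → R) (a b : ℤ) : R :=
  ∑ m ∈ Finset.range (b.toNat + 1), contractionWeight K m • (p (a + m) * p (b - m))

/-- The terms with `m > b` vanish. A longer range lets the contractions at `b` and at `b - k` be
summed over the same index set. -/
theorem evolvedContraction_eq_sum_range {R : Type*} [CommRing R] [Algebra K R] {p : ℤ → R}
    (hp : ∀ j < 0, p j = 0) {a b : ℤ} {N : ℕ} (hN : b < N) :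
    evolvedContraction (K := K) p a b =
      ∑ m ∈ Finset.range N, contractionWeight K m • (p (a + m) * p (b - m)) := by
  rcases Nat.eq_zero_or_pos N with rfl | hN'
  · rw [evolvedContraction, Finset.range_zero, Finset.sum_empty]
    refine Finset.sum_eq_zero fun m _ => ?_
    rw [hp (b - m) (by push_cast at hN; omega), mul_zero, smul_zero]
  · refine Finset.sum_subset (fun m hm => ?_) fun m _ hm => ?_
    · simp only [Finset.mem_range] at hm ⊢; omega
    · rw [Finset.mem_range] at hm
      rw [hp (b - m) (by omega), mul_zero, smul_zero]

theorem derivation_evolvedContraction {R : Type*} [CommRing R] [Algebra K R]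
    (D : Derivation K R R) {p : ℤ → R} (hp : ∀ j < 0, p j = 0) {c : R} {k : ℕ}
    (hD : ∀ j, D (p j) = c * p (j - k)) (a b : ℤ) :
    D (evolvedContraction (K := K) p a b) = c * (evolvedContraction (K := K) p (a - k) b +
      evolvedContraction (K := K) p a (b - k)) := by
  have hb : b < (b.toNat + 1 : ℕ) := by omega
  rw [evolvedContraction_eq_sum_range hp hb, evolvedContraction_eq_sum_range hp hb,
    evolvedContraction_eq_sum_range hp (b := b - k) (N := b.toNat + 1) (by omega), map_sum,
    ← Finset.sum_add_distrib, Finset.mul_sum]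
  refine Finset.sum_congr rfl fun m _ => ?_
  rw [Derivation.map_smul, Derivation.leibniz, hD, hD, ← smul_add, mul_smul_comm,
    show a + m - k = a - k + m by ring, show b - m - k = b - k - m by ring]
  simp only [smul_eq_mul]
  congr 1
  ring

theorem evolvedContraction_initial (a b : ℤ) :
    evolvedContraction (K := K) (fun j => if j = 0 then (1 : K) else 0) a b
      = contraction K a b := by
  rw [evolvedContraction, contraction]
  by_cases hb : 0 ≤ b
  · rw [Finset.sum_eq_single b.toNat]
    · rw [Int.toNat_of_nonneg hb, sub_self, if_pos rfl, mul_one, contractionWeight]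
      by_cases hab : a = -b
      · have h : a + b = 0 := by omega
        rw [if_pos h, if_pos hab]
        rcases hb.eq_or_lt with rfl | hb'
        · simp [hab]
        · rw [if_neg (by omega), if_pos (by omega), smul_eq_mul, mul_one]
          congr 1; omega
      · have h : ¬ a + b = 0 := by omega
        rw [if_neg h, if_neg hab, smul_zero]
    · intro m hm hmb
      rw [Finset.mem_range] at hm
      rw [if_neg (c := b - m = 0) (by omega), mul_zero, smul_zero]
    · intro h; simp at h
  · rw [Finset.sum_eq_zero]
    · by_cases hab : a = -b
      · rw [if_pos hab, if_neg (by omega), if_neg (by omega)]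
      · rw [if_neg hab]
    · intro m _
      rw [if_neg (c := b - m = 0) (by omega), mul_zero, smul_zero]

variable {A : Type*} [Ring A] [Algebra K A] [CharZero K]

/-- The expectation values of words of neutral fermions, as functions of the times. -/
theorem evolved_word {ψ : ℤ → A} {ω : (σ →₀ ℕ) → A →ₗ[K] K} {h : σ → A} {c : σ → K} {k : σ → ℕ}
    {p : ℤ → MvPowerSeries σ K} (hcomm : ∀ i n, h i * ψ n = ψ n * h i + c i • ψ (n - k i))
    (heuler : ∀ d x, (d.degree : K) * ω d x =
      ∑ i ∈ d.support, ω (d - Finsupp.single i 1) (h i * x))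
    (hann : ∀ d i x, ω d (x * h i) = 0)
    (hinit : ∀ l, ω 0 (word ψ l) = pfaffian (contraction K) l)
    (hp : ∀ j < 0, p j = 0)
    (hp0 : ∀ j, MvPowerSeries.constantCoeff (p j) = if j = 0 then 1 else 0)
    (hD : ∀ i j, MvPowerSeries.pderiv K i (p j) = MvPowerSeries.C (c i) * p (j - k i))
    (d : σ →₀ ℕ) (l : List ℤ) :
    ω d (word ψ l) =
      MvPowerSeries.coeff d (pfaffian (evolvedContraction (K := K) p) l) := by
  induction hn : d.degree generalizing d l with
  | zero =>
    -- At time zero `p j` is `1` for `j = 0` and `0` otherwise, so the evolved contraction becomes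
    -- the plain one.
    obtain rfl := Finsupp.degree_eq_zero_iff d |>.mp hn
    rw [hinit, MvPowerSeries.coeff_zero_eq_constantCoeff_apply, ringHom_pfaffian]
    congr 1
    ext a b
    rw [← evolvedContraction_initial]
    simp only [evolvedContraction, map_sum, MvPowerSeries.smul_eq_C_mul, map_mul, hp0,
      MvPowerSeries.constantCoeff_C, smul_eq_mul]
  | succ n ih =>
    have hd : (d.degree : K) ≠ 0 := by rw [hn]; exact_mod_cast Nat.succ_ne_zero n
    refine mul_left_cancel₀ hd ?_
    rw [heuler, natCast_degree_mul_coeff]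
    refine Finset.sum_congr rfl fun i hi => ?_
    have hdeg : (d - Finsupp.single i 1).degree = n := by
      have h1 : Finsupp.single i 1 ≤ d := by
        rw [Finsupp.single_le_iff]
        exact Nat.one_le_iff_ne_zero.mpr (Finsupp.mem_support_iff.mp hi)
      have h2 := congrArg Finsupp.degree (tsub_add_cancel_of_le h1)
      rw [map_add, Finsupp.degree_single] at h2
      omega
    -- Both sides of the Euler identity are now sums over shifted letters: on the left `h i` is
    -- commuted through to the vacuum that it annihilates, on the right the Pfaffian is
    -- differentiated.
    rw [mul_word_of_commutator (hcomm i), map_add, hann, zero_add, map_smul,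
      derivation_pfaffian _ (fun n => n - (k i : ℤ)) (MvPowerSeries.C (c i)) _
        (derivation_evolvedContraction _ hp (hD i)),
      ← LinearMap.toAddMonoidHom_coe, shiftSum_map, MvPowerSeries.coeff_C_mul,
      ← LinearMap.toAddMonoidHom_coe, shiftSum_map, smul_eq_mul]
    congr 1
    exact shiftSum_congr _ fun m _ => ih _ m hdeg

end Evolution

end SchurQ

namespace NeutralFermion

/-! ### Exponentials of linear series with noncommuting coefficients -/

section FormalExp

variable {σ E : Type*} [Ring E]

theorem coeff_linearSeries_eq_sum (A : σ → E) (v : σ →₀ ℕ) {s : Finset σ} (hs : v.support ⊆ s) :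
    MvPowerSeries.coeff v (linearSeries A) =
      ∑ i ∈ s, MvPowerSeries.coeff v (MvPowerSeries.monomial (Finsupp.single i 1) (A i)) := by
  classical
  refine Finset.sum_subset hs fun i _ hi => ?_
  rw [MvPowerSeries.coeff_monomial, if_neg]
  rintro rfl
  simp at hi

theorem single_one_le_iff_mem_support {d : σ →₀ ℕ} {i : σ} :
    Finsupp.single i 1 ≤ d ↔ i ∈ d.support := by
  rw [Finsupp.single_le_iff, Nat.one_le_iff_ne_zero, Finsupp.mem_support_iff]

theorem coeff_mul_linearSeries (A : σ → E) (f : MvPowerSeries σ E) (d : σ →₀ ℕ) :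
    MvPowerSeries.coeff d (f * linearSeries A) =
      ∑ i ∈ d.support, MvPowerSeries.coeff (d - Finsupp.single i 1) f * A i := by
  classical
  have h : MvPowerSeries.coeff d (f * linearSeries A) = ∑ i ∈ d.support,
      MvPowerSeries.coeff d (f * MvPowerSeries.monomial (Finsupp.single i 1) (A i)) := by
    simp only [MvPowerSeries.coeff_mul]
    rw [Finset.sum_comm]
    refine Finset.sum_congr rfl fun u hu => ?_
    rw [← Finset.mul_sum, coeff_linearSeries_eq_sum A u.2 (s := d.support)]
    rw [Finset.HasAntidiagonal.mem_antidiagonal] at hu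
    rw [← hu]
    exact Finsupp.support_mono le_add_self
  rw [h]
  refine Finset.sum_congr rfl fun i hi => ?_
  rw [MvPowerSeries.coeff_mul_monomial, if_pos (single_one_le_iff_mem_support.mpr hi)]

theorem coeff_linearSeries_mul (A : σ → E) (f : MvPowerSeries σ E) (d : σ →₀ ℕ) :
    MvPowerSeries.coeff d (linearSeries A * f) =
      ∑ i ∈ d.support, A i * MvPowerSeries.coeff (d - Finsupp.single i 1) f := by
  classical
  have h : MvPowerSeries.coeff d (linearSeries A * f) = ∑ i ∈ d.support,
      MvPowerSeries.coeff d (MvPowerSeries.monomial (Finsupp.single i 1) (A i) * f) := by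
    simp only [MvPowerSeries.coeff_mul]
    rw [Finset.sum_comm]
    refine Finset.sum_congr rfl fun u hu => ?_
    rw [← Finset.sum_mul, coeff_linearSeries_eq_sum A u.1 (s := d.support)]
    rw [Finset.HasAntidiagonal.mem_antidiagonal] at hu
    rw [← hu]
    exact Finsupp.support_mono le_self_add
  rw [h]
  refine Finset.sum_congr rfl fun i hi => ?_
  rw [MvPowerSeries.coeff_monomial_mul, if_pos (single_one_le_iff_mem_support.mpr hi)]

theorem degree_sub_single {d : σ →₀ ℕ} {i : σ} (hi : i ∈ d.support) :
    (d - Finsupp.single i 1).degree + 1 = d.degree := by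
  have h := congrArg Finsupp.degree
    (tsub_add_cancel_of_le (single_one_le_iff_mem_support.mpr hi))
  rwa [map_add, Finsupp.degree_single] at h

/-- The `j`-th power is homogeneous of degree `j`, so a single term of the exponential contributes
to each coefficient. Splitting one factor off that power on the right or on the left yields the
Euler identities below, without any commutation among the coefficients `A i`. -/
theorem coeff_linearSeries_pow_of_ne (A : σ → E) (d : σ →₀ ℕ) (j : ℕ) (h : d.degree ≠ j) :
    MvPowerSeries.coeff d (linearSeries A ^ j) = 0 := by
  classical
  induction j generalizing d with
  | zero =>
    rw [pow_zero, MvPowerSeries.coeff_one, if_neg]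
    rintro rfl
    simp at h
  | succ j ih =>
    rw [pow_succ, coeff_mul_linearSeries]
    refine Finset.sum_eq_zero fun i hi => ?_
    rw [ih, zero_mul]
    have := degree_sub_single hi
    omega

variable {K : Type*} [Field K] [Algebra K E]

theorem coeff_formalExp_linearSeries (A : σ → E) (d : σ →₀ ℕ) :
    MvPowerSeries.coeff d (formalExp K (linearSeries A)) =
      ((d.degree.factorial : K)⁻¹) • MvPowerSeries.coeff d (linearSeries A ^ d.degree) := by
  change ∑ j ∈ Finset.range (d.degree + 1),
    ((Nat.factorial j : K)⁻¹) • MvPowerSeries.coeff d (linearSeries A ^ j) = _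
  refine Finset.sum_eq_single d.degree (fun j _ hj => ?_) fun h => ?_
  · rw [coeff_linearSeries_pow_of_ne A d j hj.symm, smul_zero]
  · simp at h

theorem coeff_zero_formalExp_linearSeries (A : σ → E) :
    MvPowerSeries.coeff 0 (formalExp K (linearSeries A)) = 1 := by
  rw [coeff_formalExp_linearSeries]
  simp

variable [CharZero K]

theorem degree_smul_inv_factorial {d d' : ℕ} (h : d' + 1 = d) :
    (d : K) * (d.factorial : K)⁻¹ = (d'.factorial : K)⁻¹ := by
  subst h
  have : ((d' + 1 : ℕ) : K) ≠ 0 := by exact_mod_cast Nat.succ_ne_zero d'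
  rw [Nat.factorial_succ, Nat.cast_mul, mul_inv, mul_inv_cancel_left₀ this]

/-- The Euler identity for the exponential of a linear series, with the coefficients on the
right. -/
theorem degree_smul_coeff_formalExp_right (A : σ → E) (d : σ →₀ ℕ) :
    (d.degree : K) • MvPowerSeries.coeff d (formalExp K (linearSeries A)) =
      ∑ i ∈ d.support,
        MvPowerSeries.coeff (d - Finsupp.single i 1) (formalExp K (linearSeries A)) * A i := by
  rcases h : d.degree with _ | n
  · obtain rfl := Finsupp.degree_eq_zero_iff d |>.mp h
    simp
  · rw [coeff_formalExp_linearSeries, h, pow_succ, coeff_mul_linearSeries, smul_smul,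
      degree_smul_inv_factorial rfl, Finset.smul_sum]
    refine Finset.sum_congr rfl fun i hi => ?_
    have hn : (d - Finsupp.single i 1).degree = n := by
      have := degree_sub_single hi
      omega
    rw [coeff_formalExp_linearSeries, hn,
      smul_mul_assoc]

/-- The Euler identity for the exponential of a linear series, with the coefficients on the
left. -/
theorem degree_smul_coeff_formalExp_left (A : σ → E) (d : σ →₀ ℕ) :
    (d.degree : K) • MvPowerSeries.coeff d (formalExp K (linearSeries A)) =
      ∑ i ∈ d.support,
        A i * MvPowerSeries.coeff (d - Finsupp.single i 1) (formalExp K (linearSeries A)) := by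
  rcases h : d.degree with _ | n
  · obtain rfl := Finsupp.degree_eq_zero_iff d |>.mp h
    simp
  · rw [coeff_formalExp_linearSeries, h, pow_succ', coeff_linearSeries_mul, smul_smul,
      degree_smul_inv_factorial rfl, Finset.smul_sum]
    refine Finset.sum_congr rfl fun i hi => ?_
    have hn : (d - Finsupp.single i 1).degree = n := by
      have := degree_sub_single hi
      omega
    rw [coeff_formalExp_linearSeries, hn,
      mul_smul_comm]

end FormalExp

end NeutralFermion

namespace SchurQ

open NeutralFermion

/-! ### The polynomials `q_n` and their derivatives -/

section ElementaryQ

variable (K : Type*) [Field K]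

/-- The exponent `2 ∑_m s_m z^m` in the generating function of the `q_n`. -/
def qExponent : PowerSeries (MvPolynomial OddIndex K) :=
  PowerSeries.mk fun m => if h : Odd m then 2 * MvPolynomial.X ⟨m, h⟩ else 0

theorem q_eq_sum (n : ℕ) : q K n = ∑ j ∈ Finset.range (n + 1),
    ((Nat.factorial j : K)⁻¹) • PowerSeries.coeff n (qExponent K ^ j) := by
  change ∑ j ∈ Finset.range ((Finsupp.single () n).degree + 1), _ = _
  rw [Finsupp.degree_single]
  rfl

theorem coeff_qExponent_pow {n j : ℕ} (h : n < j) :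
    PowerSeries.coeff n (qExponent K ^ j) = 0 := by
  refine PowerSeries.X_pow_dvd_iff.mp (pow_dvd_pow_of_dvd ?_ j) n h
  rw [PowerSeries.X_dvd_iff, ← PowerSeries.coeff_zero_eq_constantCoeff_apply, qExponent,
    PowerSeries.coeff_mk, dif_neg (by simp)]

theorem q_eq_sum_range {n N : ℕ} (h : n < N) : q K n = ∑ j ∈ Finset.range N,
    ((Nat.factorial j : K)⁻¹) • PowerSeries.coeff n (qExponent K ^ j) := by
  rw [q_eq_sum]
  refine Finset.sum_subset (fun m hm => ?_) fun m _ hm => ?_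
  · simp only [Finset.mem_range] at hm ⊢; omega
  · rw [Finset.mem_range] at hm
    rw [coeff_qExponent_pow K (by omega), smul_zero]

variable {K} in
/-- A derivation of the coefficients, acting on power series. -/
def coeffDerivation {R : Type*} [CommRing R] [Algebra K R] (D : Derivation K R R) :
    Derivation K (PowerSeries R) (PowerSeries R) :=
  Derivation.mk'
    { toFun := fun f => PowerSeries.mk fun n => D (PowerSeries.coeff n f)
      map_add' := fun f g => by ext n; simp
      map_smul' := fun c f => by
        ext n
        simp only [PowerSeries.coeff_mk, RingHom.id_apply]
        rw [← algebraMap_smul R c f, PowerSeries.coeff_smul, smul_eq_mul,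
          ← Algebra.smul_def, Derivation.map_smul, ← algebraMap_smul R c (PowerSeries.mk _),
          PowerSeries.coeff_smul, PowerSeries.coeff_mk, smul_eq_mul, ← Algebra.smul_def] }
    fun f g => by
      ext n
      simp only [LinearMap.coe_mk, AddHom.coe_mk, PowerSeries.coeff_mk, smul_eq_mul, map_add,
        PowerSeries.coeff_mul, map_sum, Derivation.leibniz, Finset.sum_add_distrib]
      congr 1
      exact Finset.sum_equiv (Equiv.prodComm ℕ ℕ) (by simp [add_comm]) (by simp)

variable {K} in
theorem coeff_coeffDerivation {R : Type*} [CommRing R] [Algebra K R] (D : Derivation K R R)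
    (f : PowerSeries R) (n : ℕ) :
    PowerSeries.coeff n (coeffDerivation D f) = D (PowerSeries.coeff n f) := by
  change PowerSeries.coeff n (PowerSeries.mk fun n => D (PowerSeries.coeff n f)) = _
  exact PowerSeries.coeff_mk _ _

theorem coeffDerivation_qExponent (k : OddIndex) :
    coeffDerivation (MvPolynomial.pderiv k) (qExponent K) = 2 * PowerSeries.X ^ (k : ℕ) := by
  classical
  ext1 n
  have h2 : (2 : PowerSeries (MvPolynomial OddIndex K)) = PowerSeries.C 2 :=
    (map_ofNat PowerSeries.C 2).symm
  rw [coeff_coeffDerivation, qExponent, PowerSeries.coeff_mk, h2, PowerSeries.coeff_C_mul,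
    PowerSeries.coeff_X_pow]
  have h3 : (2 : MvPolynomial OddIndex K) = MvPolynomial.C 2 :=
    (map_ofNat MvPolynomial.C 2).symm
  by_cases h : n = (k : ℕ)
  · subst h
    rw [dif_pos k.2, if_pos rfl, h3, MvPolynomial.pderiv_C_mul]
    simp
  · rw [if_neg h, mul_zero]
    split_ifs with ho
    · rw [h3, MvPolynomial.pderiv_C_mul, MvPolynomial.pderiv_X_of_ne, mul_zero]
      rintro rfl
      exact h rfl
    · exact map_zero _

/-- Differentiate the generating series: `∂_k exp(E) = 2 z^k exp(E)` for the exponent `E`, checked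
on each power of `E` with `(j+1)/(j+1)! = 1/j!`. -/
theorem pderiv_q [CharZero K] (k : OddIndex) (n : ℕ) :
    MvPolynomial.pderiv k (q K n) = if (k : ℕ) ≤ n then 2 * q K (n - k) else 0 := by
  have hkey : ∀ j, MvPolynomial.pderiv k (PowerSeries.coeff n (qExponent K ^ (j + 1))) =
      if (k : ℕ) ≤ n then
        ((j + 1 : ℕ) : K) • (2 * PowerSeries.coeff (n - k) (qExponent K ^ j)) else 0 := by
    intro j
    rw [← coeff_coeffDerivation, Derivation.leibniz_pow, coeffDerivation_qExponent,
      Nat.add_sub_cancel, smul_eq_mul, ← mul_assoc, mul_comm _ (2 : PowerSeries _), mul_assoc,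
      nsmul_eq_mul, ← mul_assoc, ← mul_assoc, PowerSeries.coeff_mul_X_pow']
    split_ifs
    · have h2 : ((j + 1 : ℕ) : PowerSeries (MvPolynomial OddIndex K)) * 2
          = PowerSeries.C (((j + 1 : ℕ) : MvPolynomial OddIndex K) * 2) := by
        rw [map_mul, map_natCast, map_ofNat]
      rw [h2, PowerSeries.coeff_C_mul, Nat.cast_smul_eq_nsmul, nsmul_eq_mul, mul_assoc]
    · rfl
  rw [q_eq_sum_range K (Nat.lt_succ_self n), Finset.sum_range_succ', map_add, map_sum]
  have h0 : MvPolynomial.pderiv k ((Nat.factorial 0 : K)⁻¹ •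
      PowerSeries.coeff n (qExponent K ^ 0)) = 0 := by
    rw [Derivation.map_smul, pow_zero, PowerSeries.coeff_one]
    split_ifs <;> simp
  rw [h0, add_zero]
  simp only [Derivation.map_smul, hkey]
  split_ifs with hk
  -- After the shift of `j` the sum runs over `j < n`; since `k > 0` this range still contains every
  -- nonzero term of `q (n - k)`.
  · have hn : n - k < n := by have := k.2.pos; omega
    rw [q_eq_sum_range K hn, Finset.mul_sum]
    refine Finset.sum_congr rfl fun j _ => ?_
    rw [smul_smul, mul_smul_comm, mul_comm ((Nat.factorial (j + 1) : K)⁻¹),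
      degree_smul_inv_factorial rfl]
  · simp

theorem constantCoeff_q (n : ℕ) :
    MvPolynomial.constantCoeff (q K n) = if n = 0 then 1 else 0 := by
  have h : PowerSeries.map MvPolynomial.constantCoeff (qExponent K) = 0 := by
    ext m
    rw [PowerSeries.coeff_map, qExponent, PowerSeries.coeff_mk]
    split_ifs <;> simp
  have hj : ∀ j, MvPolynomial.constantCoeff (PowerSeries.coeff n (qExponent K ^ j)) =
      PowerSeries.coeff n ((0 : PowerSeries K) ^ j) := by
    intro j
    rw [← PowerSeries.coeff_map, map_pow, h]
  rw [q_eq_sum, map_sum, Finset.sum_range_succ']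
  simp only [MvPolynomial.smul_eq_C_mul, map_mul, hj]
  simp [PowerSeries.coeff_one]

/-- Substitution of the halved times `t/2`, where `v` selects the family of times. -/
def halfTimes (v : OddIndex → Times) : MvPolynomial OddIndex K →ₐ[K] MvPowerSeries Times K :=
  MvPolynomial.aeval fun n => (1 / 2 : K) • MvPowerSeries.X (v n)

/-- The series `q_j(t/2)`, extended by zero to negative indices. -/
def qHalf (v : OddIndex → Times) (j : ℤ) : MvPowerSeries Times K :=
  if j < 0 then 0 else halfTimes K v (q K j.toNat)

variable {K}

theorem qHalf_neg (v : OddIndex → Times) (j : ℤ) (hj : j < 0) : qHalf K v j = 0 := if_pos hj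

theorem qHalf_natCast (v : OddIndex → Times) (n : ℕ) : qHalf K v n = halfTimes K v (q K n) := by
  simp [qHalf]

theorem constantCoeff_halfTimes (v : OddIndex → Times) (P : MvPolynomial OddIndex K) :
    MvPowerSeries.constantCoeff (halfTimes K v P) = MvPolynomial.constantCoeff P := by
  have : (MvPowerSeries.constantCoeff (σ := Times) (R := K)).comp (halfTimes K v).toRingHom =
      MvPolynomial.constantCoeff := by
    refine MvPolynomial.ringHom_ext (fun c => ?_) fun i => ?_
    · simp [MvPowerSeries.algebraMap_apply]
    · simp [halfTimes, MvPowerSeries.smul_eq_C_mul]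
  exact DFunLike.congr_fun this P

theorem constantCoeff_qHalf (v : OddIndex → Times) (j : ℤ) :
    MvPowerSeries.constantCoeff (qHalf K v j) = if j = 0 then 1 else 0 := by
  rw [qHalf]
  split_ifs with h1 h2 h2
  · omega
  · simp
  · rw [constantCoeff_halfTimes, constantCoeff_q, if_pos (by omega)]
  · rw [constantCoeff_halfTimes, constantCoeff_q, if_neg (by omega)]

theorem pderiv_halfTimes {v : OddIndex → Times} (hv : Function.Injective v) (k : OddIndex)
    (P : MvPolynomial OddIndex K) :
    MvPowerSeries.pderiv K (v k) (halfTimes K v P) =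
      (1 / 2 : K) • halfTimes K v (MvPolynomial.pderiv k P) := by
  classical
  induction P using MvPolynomial.induction_on with
  | C a => simp [MvPowerSeries.algebraMap_apply]
  | add p q hp hq => simp only [map_add, hp, hq, smul_add]
  | mul_X p i hp =>
    have hX : halfTimes K v (MvPolynomial.X i) = (1 / 2 : K) • MvPowerSeries.X (v i) := by
      simp [halfTimes]
    rw [map_mul, Derivation.leibniz, hp, Derivation.leibniz, map_add, hX, Derivation.map_smul,
      MvPowerSeries.pderiv_X, MvPolynomial.pderiv_X]
    simp only [smul_eq_mul, map_mul, hX, smul_add]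
    by_cases h : i = k
    · subst h
      simp [mul_comm]
    · have h' : v k ≠ v i := fun h' => h (hv h').symm
      simp [h, h', mul_comm]

theorem pderiv_halfTimes_of_notMem {v : OddIndex → Times} {i : Times} (hi : ∀ n, v n ≠ i)
    (P : MvPolynomial OddIndex K) : MvPowerSeries.pderiv K i (halfTimes K v P) = 0 := by
  induction P using MvPolynomial.induction_on with
  | C a => simp [MvPowerSeries.algebraMap_apply]
  | add p q hp hq => simp only [map_add, hp, hq, add_zero]
  | mul_X p n hp =>
    have hX : halfTimes K v (MvPolynomial.X n) = (1 / 2 : K) • MvPowerSeries.X (v n) := by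
      simp [halfTimes]
    rw [map_mul, Derivation.leibniz, hp, hX, Derivation.map_smul,
      MvPowerSeries.pderiv_X_of_ne (hi n)]
    simp

/-- The chain rule factor `1/2` cancels the `2` in `∂_k q_n = 2 q_{n-k}`. With the extension by zero
to negative indices the rule is uniform in `j`, as `evolved_word` requires. -/
theorem pderiv_qHalf [CharZero K] {v : OddIndex → Times} (hv : Function.Injective v)
    (k : OddIndex) (j : ℤ) :
    MvPowerSeries.pderiv K (v k) (qHalf K v j) = qHalf K v (j - (k : ℕ)) := by
  rw [qHalf, qHalf]
  split_ifs with h1 h2 h2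
  · exact map_zero _
  · omega
  · rw [pderiv_halfTimes hv, pderiv_q, if_neg (by omega), map_zero, smul_zero]
  · rw [pderiv_halfTimes hv, pderiv_q, if_pos (by omega), map_mul, map_ofNat,
      show (j - ((k : ℕ) : ℤ)).toNat = j.toNat - k by omega,
      MvPowerSeries.smul_eq_C_mul, ← mul_assoc,
      ← map_ofNat (MvPowerSeries.C (σ := Times) (R := K)), ← map_mul]
    norm_num

theorem pderiv_qHalf_of_notMem {v : OddIndex → Times} {i : Times} (hi : ∀ n, v n ≠ i) (j : ℤ) :
    MvPowerSeries.pderiv K i (qHalf K v j) = 0 := by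
  rw [qHalf]
  split_ifs
  · exact map_zero _
  · exact pderiv_halfTimes_of_notMem hi _

/-- The weights `1/2, -1, 1, -1, …` of the contraction are half the coefficients `1, -2, 2, -2, …`
in `Q_{(a,b)}`. -/
theorem evolvedContraction_qHalf [CharZero K] (v : OddIndex → Times) (a b : ℕ) :
    evolvedContraction (K := K) (qHalf K v) a b =
      halfTimes K v (MvPolynomial.C (1 / 2) * Q2 K a b) := by
  have hb : ((b : ℕ) : ℤ).toNat = b := by simp
  have h : ∀ m ∈ Finset.range (b + 1), contractionWeight K m • (qHalf K v ((a : ℤ) + m) *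
      qHalf K v ((b : ℤ) - m)) =
      halfTimes K v (contractionWeight K m • (q K (a + m) * q K (b - m))) := by
    intro m hm
    rw [Finset.mem_range] at hm
    rw [show (b : ℤ) - m = ((b - m : ℕ) : ℤ) by omega, ← Nat.cast_add, qHalf_natCast,
      qHalf_natCast, map_smul, map_mul]
  rw [evolvedContraction, hb, Finset.sum_congr rfl h, ← map_sum]
  congr 1
  rw [Finset.sum_range_succ', Q2, ← Finset.Ico_add_one_right_eq_Icc,
    Finset.sum_Ico_eq_sum_range, Nat.add_sub_cancel, mul_add, add_comm,
    ← mul_assoc _ (2 : MvPolynomial OddIndex K)]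
  have h2 : MvPolynomial.C (1 / 2 : K) * (2 : MvPolynomial OddIndex K) = 1 := by
    rw [← map_ofNat (MvPolynomial.C (σ := OddIndex) (R := K)), ← map_mul]
    norm_num
  rw [h2, one_mul]
  congr 1
  · simp [contractionWeight, MvPolynomial.smul_eq_C_mul]
  · refine Finset.sum_congr rfl fun m _ => ?_
    rw [contractionWeight, if_neg (by omega), add_comm 1 m, MvPolynomial.smul_eq_C_mul, map_pow,
      map_neg, map_one]

end ElementaryQ

end SchurQ

namespace NeutralFermion

open SchurQ MulOpposite

variable {K : Type*} [Field K]

/-! ### Vacuum expectation values of words in the neutral fermions -/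

section Vacuum

/-- Right multiplication by `e_0` commutes with creation by associativity, and with annihilation
because the contraction with a mode of positive index kills `e_0`. -/
theorem phi_mul_phi_zero (n : ℤ) (x : Fock K) :
    phi K n (x * phi K 0 (vac K)) = phi K n x * phi K 0 (vac K) := by
  have h0 : phi K 0 (vac K) = CliffordAlgebra.ι (modeForm K) (Finsupp.single 0 1) := by
    simpa [vac] using phi_natCast (K := K) 0 (vac K)
  rw [h0]
  rcases n with n | n
  · exact (mul_assoc _ _ _).symm
  · have hc : ∀ y : Fock K, phi K (Int.negSucc n) y = (-1 : K) ^ (n + 1) •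
        CliffordAlgebra.contractLeft (Q := modeForm K) (Finsupp.lapply (n + 1)) y :=
      fun y => rfl
    rw [hc, hc, smul_mul_assoc]
    congr 1
    induction x using CliffordAlgebra.left_induction with
    | algebraMap r =>
      rw [CliffordAlgebra.contractLeft_algebraMap_mul, CliffordAlgebra.contractLeft_ι,
        CliffordAlgebra.contractLeft_algebraMap]
      simp
    | add x y hx hy => simp only [add_mul, map_add, hx, hy]
    | ι_mul x v hx =>
      rw [mul_assoc, CliffordAlgebra.contractLeft_ι_mul, hx, CliffordAlgebra.contractLeft_ι_mul,
        sub_mul, smul_mul_assoc, mul_assoc]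

variable [CharZero K]

theorem phi_comm_of_ne {m n : ℤ} (h : m ≠ -n) (x : Fock K) :
    phi K m (phi K n x) = -phi K n (phi K m x) := by
  have h1 := congrArg (fun f => f x) (phi_anticomm (K := K) m n)
  rw [if_neg h] at h1
  exact eq_neg_of_add_eq_zero_left h1

theorem covac_phi_zero_pow_phi (k : ℕ) {n : ℤ} (hn : 0 < n) (x : Fock K) :
    covac K ((phi K 0 ^ k) (phi K n x)) = 0 := by
  induction k generalizing x with
  | zero => exact covac_phi hn x
  | succ k ih =>
    rw [pow_succ, Module.End.mul_apply, phi_comm_of_ne (by omega), map_neg, map_neg, ih, neg_zero]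

/-- This provides the hypothesis `hcomm` of Wick's theorem. By linearity `x` may be taken as a
product of modes: a leading mode `n > 0` makes both sides vanish, and leading modes `0` are
collected. -/
theorem covac_mul_phi_zero (x : Fock K) :
    covac K (x * phi K 0 (vac K)) = covac K (phi K 0 x) := by
  -- The power of `φ_0` strengthens the induction: it absorbs the leading factors `φ_0` of `x`.
  have h : ∀ k : ℕ, covac K ((phi K 0 ^ k) (x * phi K 0 (vac K))) =
      covac K ((phi K 0 ^ k) (phi K 0 x)) := by
    induction x using CliffordAlgebra.left_induction with
    | algebraMap c =>
      intro k
      rw [Algebra.algebraMap_eq_smul_one, smul_mul_assoc, one_mul, map_smul (phi K 0)]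
      rfl
    | add x y hx hy => intro k; simp only [add_mul, map_add, hx k, hy k]
    | ι_mul x v hx =>
      intro k
      induction v using Finsupp.induction_linear with
      | zero => simp
      | add f g hf hg => simp only [map_add, add_mul, hf, hg]
      | single n c =>
        have h : Finsupp.single n c = c • Finsupp.single n (1 : K) := by simp
        rw [h, map_smul, smul_mul_assoc, smul_mul_assoc]
        simp only [map_smul]
        congr 1
        rw [mul_assoc, ← phi_natCast, ← phi_natCast]
        rcases Nat.eq_zero_or_pos n with rfl | hn
        · have h2 := hx (k + 1)
          simpa only [pow_succ, Module.End.mul_apply, Nat.cast_zero] using h2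
        · rw [covac_phi_zero_pow_phi k (by omega), phi_comm_of_ne (by omega), map_neg, map_neg,
            covac_phi_zero_pow_phi k (by omega), neg_zero]
  simpa using h 0

theorem covac_apply_phi_zero {X : Module.End K (Fock K)}
    (hX : ∀ x, X (x * phi K 0 (vac K)) = X x * phi K 0 (vac K)) :
    covac K (X (phi K 0 (vac K))) = covac K (phi K 0 (X (vac K))) := by
  have h := hX (vac K)
  rw [vac, one_mul] at h
  rw [← covac_mul_phi_zero, vac, h]

variable (K) in
theorem isNeutral_phi : IsNeutral K (phi K) := by
  intro m n
  rw [phi_anticomm]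
  split_ifs <;> simp

variable (K) in
/-- The adjoints `(-1)^n φ_{-n}` of the neutral fermions, with reversed multiplication. -/
def phiStar (n : ℤ) : (Module.End K (Fock K))ᵐᵒᵖ := op ((-1 : K) ^ n.natAbs • phi K (-n))

variable (K) in
theorem isNeutral_phiStar : IsNeutral K (phiStar K) := by
  intro m n
  rw [phiStar, phiStar, ← op_mul, ← op_mul, ← op_add, ← op_one, ← op_smul]
  congr 1
  simp only [smul_mul_smul_comm]
  rw [mul_comm ((-1 : K) ^ n.natAbs), ← smul_add, phi_anticomm]
  by_cases h : m = -n
  · rw [if_pos h, if_pos (by omega)]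
    subst h
    rw [smul_smul, Int.natAbs_neg, ← pow_add, ← pow_add]
    congr 1
    rw [pow_add, ← two_mul, pow_mul]
    simp
  · rw [if_neg h, if_neg (by omega), smul_zero, zero_smul]

theorem covac_word_phi (l : List ℤ) :
    covac K (word (phi K) l (vac K)) = pfaffian (contraction K) l := by
  refine (isNeutral_phi K).wick (covac K ∘ₗ LinearMap.applyₗ (vac K)) ?_ ?_ ?_ ?_ ?_ l
  · exact covac_vac
  · exact covac_phi_zero_vac
  · exact fun m x hm => covac_phi hm _
  · intro m x hm
    change covac K (x (phi K m (vac K))) = 0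
    rw [phi_vac hm, map_zero, map_zero]
  · intro l
    refine covac_apply_phi_zero fun x => ?_
    induction l generalizing x with
    | nil => rfl
    | cons n l ih =>
      rw [word_cons, Module.End.mul_apply, ih, phi_mul_phi_zero]
      rfl

/-- Reversing the product and replacing `n` by `-n` exchanges the roles of the two vacua, so the
hypotheses of Wick's theorem hold again. -/
theorem covac_word_phiStar (l : List ℤ) :
    covac K ((word (phiStar K) l).unop (vac K)) = pfaffian (contraction K) l := by
  have h0 : (phiStar K 0).unop = phi K 0 := by simp [phiStar]
  refine (isNeutral_phiStar K).wick (covac K ∘ₗ LinearMap.applyₗ (vac K) ∘ₗ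
    (opLinearEquiv K).symm.toLinearMap) ?_ ?_ ?_ ?_ ?_ l
  · exact covac_vac
  · change covac K ((phiStar K 0).unop (vac K)) = 0
    rw [h0]
    exact covac_phi_zero_vac
  · intro m x hm
    change covac K (x.unop ((-1 : K) ^ m.natAbs • phi K (-m) (vac K))) = 0
    rw [phi_vac (by omega), smul_zero, map_zero, map_zero]
  · intro m x hm
    change covac K ((-1 : K) ^ m.natAbs • phi K (-m) _) = 0
    rw [map_smul, covac_phi (by omega), smul_zero]
  · intro l
    change covac K ((phiStar K 0).unop ((word (phiStar K) l).unop (vac K))) =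
      covac K ((word (phiStar K) l).unop ((phiStar K 0).unop (vac K)))
    rw [h0]
    refine (covac_apply_phi_zero fun x => ?_).symm
    induction l generalizing x with
    | nil => rfl
    | cons n l ih =>
      rw [word_cons, unop_mul, Module.End.mul_apply, phiStar, unop_op, LinearMap.smul_apply,
        phi_mul_phi_zero, ← smul_mul_assoc, ih]
      rfl

end Vacuum

/-! ### Bilinear operators and their commutators with the fermions -/

section Bilinear

theorem neg_one_pow_natAbs (n : ℤ) : (-1 : K) ^ n.natAbs = (-1) ^ n := by
  rcases Int.even_or_odd n with h | h
  · rw [h.neg_one_zpow, (Int.natAbs_even.mpr h).neg_one_pow]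
  · rw [h.neg_one_zpow, (Int.natAbs_odd.mpr h).neg_one_pow]

variable [CharZero K]

/-- The bilinear operators `∑_n c_n φ_n φ_{k-n}`, for `k ≠ 0`. -/
def pairSum {k : ℤ} (hk : k ≠ 0) (c : ℤ → K) : Module.End K (Fock K) :=
  pointwiseSum (fun n => c n • (phi K n * phi K (k - n))) (finite_support_phi_phi hk c)

theorem pairSum_apply {k : ℤ} (hk : k ≠ 0) (c : ℤ → K) (x : Fock K) :
    pairSum hk c x = ∑ᶠ n, c n • phi K n (phi K (k - n) x) := rfl

theorem map_pairSum {V : Type*} [AddCommGroup V] [Module K V] (f : Fock K →ₗ[K] V) {k : ℤ}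
    (hk : k ≠ 0) (c : ℤ → K) (x : Fock K) :
    f (pairSum hk c x) = ∑ᶠ n, f (c n • phi K n (phi K (k - n) x)) :=
  map_finsum f.toAddMonoidHom (finite_support_phi_phi hk c x)

/-- Only two terms of the sum fail to commute with `φ_n`: `j = n + k`, where the second factor meets
`φ_n`, and `j = -n`, where the first does. They enter with opposite signs. -/
theorem pairSum_mul_phi {k : ℤ} (hk : k ≠ 0) (c : ℤ → K) (n : ℤ) :
    pairSum hk c * phi K n =
      phi K n * pairSum hk c + ((-1 : K) ^ n.natAbs * (c (n + k) - c (-n))) • phi K (n + k) := by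
  ext1 x
  have hanti : ∀ a b : ℤ, ∀ y : Fock K, phi K a (phi K b y) =
      (if a = -b then (-1 : K) ^ a.natAbs else 0) • y - phi K b (phi K a y) := by
    intro a b y
    have h := congrArg (fun f => f y) (isNeutral_phi K a b)
    exact eq_sub_of_add_eq h
  have hterm : ∀ j : ℤ, c j • phi K j (phi K (k - j) (phi K n x)) =
      phi K n (c j • phi K j (phi K (k - j) x)) +
        ((if j = n + k then ((-1 : K) ^ n.natAbs * c (n + k)) • phi K (n + k) x else 0) +
        (if j = -n then -(((-1 : K) ^ n.natAbs * c (-n)) • phi K (n + k) x) else 0)) := by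
    intro j
    rw [hanti (k - j) n, map_sub, map_smul, hanti j n]
    -- The two exceptional indices may coincide; then their contributions cancel.
    by_cases h1 : j = n + k <;> by_cases h2 : j = -n
    · rw [if_pos h1, if_pos h2, if_pos h2, if_pos (by omega), map_smul]
      subst h2
      rw [show k - -n = n + k by ring, show (n + k).natAbs = n.natAbs by omega, ← h1,
        Int.natAbs_neg, smul_sub, smul_sub, smul_smul, mul_comm (c (-n))]
      abel
    · rw [if_pos h1, if_neg h2, if_neg h2, if_pos (by omega), map_smul]
      subst h1
      rw [show k - (n + k) = -n by ring, Int.natAbs_neg, smul_sub, smul_smul,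
        mul_comm (c (n + k))]
      simp
      abel
    · rw [if_neg h1, if_pos h2, if_pos h2, if_neg (by omega), map_smul]
      subst h2
      rw [show k - -n = n + k by ring, Int.natAbs_neg, smul_sub, smul_sub, smul_smul, smul_smul,
        mul_comm (c (-n)) ((-1) ^ n.natAbs)]
      simp
      abel
    · rw [if_neg h1, if_neg h2, if_neg h2, if_neg (by omega), map_smul]
      simp
  have hf1 : (Function.support fun j => phi K n (c j • phi K j (phi K (k - j) x))).Finite :=
    (finite_support_phi_phi hk c x).subset fun j hj => by
      rw [Function.mem_support] at hj ⊢
      contrapose! hj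
      have : c j • phi K j (phi K (k - j) x) = 0 := hj
      rw [this, map_zero]
  have hf : ∀ (a : ℤ) (y : Fock K),
      (Function.support fun j => if j = a then y else 0).Finite := fun a y =>
    (Set.finite_singleton a).subset fun j hj => by
      by_contra h
      exact hj (if_neg h)
  rw [Module.End.mul_apply, pairSum_apply, LinearMap.add_apply, Module.End.mul_apply,
    map_pairSum]
  simp only [hterm]
  rw [finsum_add_distrib hf1 (((hf _ _).union (hf _ _)).subset (Function.support_add _ _)),
    finsum_add_distrib (hf _ _) (hf _ _), finsum_eq_single _ (n + k) (fun j hj => if_neg hj),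
    finsum_eq_single _ (-n) (fun j hj => if_neg hj), if_pos rfl, if_pos rfl, mul_sub,
    LinearMap.smul_apply, sub_smul]
  abel

/-- As `k < 0`, one of the indices `n`, `k - n` is negative, and since `k ≠ 0` the two factors
anticommute. -/
theorem pairSum_vac {k : ℤ} (hk : k < 0) (c : ℤ → K) : pairSum hk.ne c (vac K) = 0 := by
  rw [pairSum_apply]
  refine finsum_eq_zero_of_forall_eq_zero fun n => ?_
  rcases lt_or_ge (k - n) 0 with h | h
  · rw [phi_vac h, map_zero, smul_zero]
  · rw [phi_comm_of_ne (by omega), phi_vac (by omega), map_zero, neg_zero, smul_zero]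

theorem covac_pairSum {k : ℤ} (hk : 0 < k) (c : ℤ → K) (x : Fock K) :
    covac K (pairSum hk.ne' c x) = 0 := by
  rw [map_pairSum]
  refine finsum_eq_zero_of_forall_eq_zero fun n => ?_
  rcases lt_or_ge 0 n with h | h
  · rw [map_smul, covac_phi h, smul_zero]
  · rw [map_smul, phi_comm_of_ne (by omega), map_neg, covac_phi (by omega), neg_zero, smul_zero]

theorem hamiltonian_mul_phi (k : OddIndex) (n : ℤ) :
    hamiltonian K k * phi K n = phi K n * hamiltonian K k + phi K (n - (k : ℕ)) := by
  have h := pairSum_mul_phi (neg_ne_zero.mpr k.ne_zero)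
    (fun k => (1 / 2 : K) * (-1) ^ (k + 1)) n
  refine h.trans ?_
  have hk : Odd ((k : ℕ) : ℤ) := by exact_mod_cast k.2
  have h2 : (-1 : K) ^ n.natAbs * ((1 / 2 : K) * (-1) ^ (n + -((k : ℕ) : ℤ) + 1) -
      (1 / 2 : K) * (-1) ^ (-n + 1)) = 1 := by
    rw [neg_one_pow_natAbs]
    rcases Int.even_or_odd n with hn | hn
    · rw [hn.neg_one_zpow, ((hn.add_odd hk.neg).add_one).neg_one_zpow,
        (hn.neg.add_one).neg_one_zpow]
      norm_num
    · rw [hn.neg_one_zpow, ((hn.add_odd hk.neg).add_one).neg_one_zpow,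
        (hn.neg.add_one).neg_one_zpow]
      norm_num
  rw [h2, one_smul]
  rfl

theorem hamiltonian_vac (k : OddIndex) : hamiltonian K k (vac K) = 0 :=
  pairSum_vac (by have := k.2.pos; omega) _

theorem covac_symmetryOp (r : ℤ → K) (k : OddIndex) (x : Fock K) :
    covac K (symmetryOp r k x) = 0 :=
  covac_pairSum (by have := k.2.pos; omega) _ _

/-- The two exceptional terms carry `r(n+k) ⋯ r(n+1)` and `r(-n) ⋯ r(-n-k+1)`. The reflection
symmetry of `r` makes these products equal, and as `k` is odd the two halves add up. -/
theorem symmetryOp_mul_phi {r : ℤ → K} (hr : ∀ n, r n = r (1 - n)) (k : OddIndex) (n : ℤ) :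
    symmetryOp r k * phi K n = phi K n * symmetryOp r k -
      (∏ i ∈ Finset.range k, r (n + (i + 1 : ℕ))) • phi K (n + (k : ℕ)) := by
  have h := pairSum_mul_phi k.ne_zero
    (fun n => (1 / 2 : K) * (-1) ^ n * ∏ i ∈ Finset.range k, r (n - i)) n
  refine h.trans ?_
  have hk : Odd ((k : ℕ) : ℤ) := by exact_mod_cast k.2
  have hp1 : ∏ i ∈ Finset.range k, r (n + ((k : ℕ) : ℤ) - i) =
      ∏ i ∈ Finset.range k, r (n + (i + 1 : ℕ)) := by
    rw [← Finset.prod_range_reflect]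
    refine Finset.prod_congr rfl fun i hi => ?_
    rw [Finset.mem_range] at hi
    congr 1
    omega
  have hp2 : ∏ i ∈ Finset.range k, r (-n - i) =
      ∏ i ∈ Finset.range k, r (n + (i + 1 : ℕ)) := by
    refine Finset.prod_congr rfl fun i hi => ?_
    rw [hr]
    congr 1
    push_cast
    ring
  have h2 : ∀ P : K, (-1 : K) ^ n.natAbs * ((1 / 2 : K) * (-1) ^ (n + ((k : ℕ) : ℤ)) * P -
      (1 / 2 : K) * (-1) ^ (-n) * P) = -P := by
    intro P
    rw [neg_one_pow_natAbs]
    rcases Int.even_or_odd n with hn | hn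
    · rw [hn.neg_one_zpow, (hn.add_odd hk).neg_one_zpow, hn.neg.neg_one_zpow]
      ring
    · rw [hn.neg_one_zpow, (hn.add_odd hk).neg_one_zpow, hn.neg.neg_one_zpow]
      ring
  rw [hp1, hp2, h2]
  ext1 x
  simp only [LinearMap.add_apply, LinearMap.sub_apply, LinearMap.smul_apply, neg_smul,
    ← sub_eq_add_neg]
  rfl

theorem phiStar_unop_mul_neg_symmetryOp (k : OddIndex) (n : ℤ) :
    (phiStar K n).unop * -symmetryOp (1 : ℤ → K) k =
      -symmetryOp (1 : ℤ → K) k * (phiStar K n).unop + (phiStar K (n - (k : ℕ))).unop := by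
  have h := symmetryOp_mul_phi (r := (1 : ℤ → K)) (fun _ => rfl) k (-n)
  have hk : Odd ((k : ℕ) : ℤ) := by exact_mod_cast k.2
  have hs : (-1 : K) ^ (n - (k : ℕ)).natAbs = -(-1 : K) ^ n.natAbs := by
    rw [neg_one_pow_natAbs, neg_one_pow_natAbs]
    rcases Int.even_or_odd n with hn | hn
    · rw [hn.neg_one_zpow, (hn.sub_odd hk).neg_one_zpow]
    · rw [hn.neg_one_zpow, (hn.sub_odd hk).neg_one_zpow, neg_neg]
  ext1 x
  have hx : symmetryOp (1 : ℤ → K) k (phi K (-n) x) =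
      phi K (-n) (symmetryOp 1 k x) - phi K (-n + (k : ℕ)) x := by
    have h' := congrArg (fun f => f x) h
    simpa using h'
  have hi : -(n - ((k : ℕ) : ℤ)) = -n + (k : ℕ) := by ring
  simp only [phiStar, unop_op, hs, Module.End.mul_apply, LinearMap.neg_apply, LinearMap.add_apply,
    LinearMap.smul_apply, map_neg, map_smul, hx, hi, neg_smul, smul_neg, smul_sub]
  abel

end Bilinear

/-! ### Both vacuum factors as Pfaffians of evolved contractions -/

section Evolution

variable [CharZero K]

theorem neg_linearSeries {σ E : Type*} [Ring E] (A : σ → E) :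
    -linearSeries A = linearSeries fun i => -A i := by
  ext d
  change -MvPowerSeries.coeff d (linearSeries A) = _
  rw [coeff_linearSeries_eq_sum A d subset_rfl, coeff_linearSeries_eq_sum _ d subset_rfl,
    ← Finset.sum_neg_distrib]
  simp only [map_neg]

theorem neg_symmetrySeries (r : ℤ → K) :
    -symmetrySeries r = linearSeries (Sum.elim (fun _ => 0) fun n => -symmetryOp r n) := by
  rw [symmetrySeries, neg_linearSeries]
  congr 1
  ext1 i
  rcases i with i | i <;> simp

theorem covac_exp_hamiltonian_word (d : Times →₀ ℕ) (l : List ℤ) :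
    covac K (MvPowerSeries.coeff d (formalExp K (hamiltonianSeries K))
      (word (phi K) l (vac K))) =
      MvPowerSeries.coeff d (pfaffian (evolvedContraction (K := K) (qHalf K Sum.inl)) l) := by
  refine evolved_word (ψ := phi K)
    (ω := fun d => covac K ∘ₗ MvPowerSeries.coeff d (formalExp K (hamiltonianSeries K)) ∘ₗ
      LinearMap.applyₗ (vac K))
    -- The variables `t*` do not occur in `H(t)`, so they get the operator `0` and the constant `c =
    -- 0`; their shift `k` is then irrelevant.
    (h := Sum.elim (fun n => hamiltonian K n) fun _ => 0)
    (c := Sum.elim (fun _ => 1) fun _ => 0)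
    (k := Sum.elim (fun n => n) fun n => n) ?_ ?_ ?_ ?_ (qHalf_neg _) (constantCoeff_qHalf _) ?_ d l
  · rintro (i | i) n
    · simp [hamiltonian_mul_phi]
    · simp
  · intro d x
    have h := congrArg (fun X => covac K (X (x (vac K))))
      (degree_smul_coeff_formalExp_right (K := K)
        (Sum.elim (fun n => hamiltonian K n) fun _ => 0) d)
    simp only [LinearMap.smul_apply, map_smul, LinearMap.sum_apply, map_sum] at h
    exact h
  · rintro d (i | i) x
    · change covac K (MvPowerSeries.coeff d (formalExp K (hamiltonianSeries K))
      (x (hamiltonian K i (vac K)))) = 0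
      simp [hamiltonian_vac]
    · change covac K (MvPowerSeries.coeff d (formalExp K (hamiltonianSeries K)) (x 0)) = 0
      simp
  · intro l
    rw [hamiltonianSeries, coeff_zero_formalExp_linearSeries]
    exact covac_word_phi l
  · rintro (i | i) j
    · simp [pderiv_qHalf Sum.inl_injective]
    · simp [pderiv_qHalf_of_notMem (v := Sum.inl) (i := Sum.inr i) (by simp)]

theorem covac_word_phiStar_exp_symmetry (d : Times →₀ ℕ) (l : List ℤ) :
    covac K ((word (phiStar K) l).unop
      (MvPowerSeries.coeff d (formalExp K (-symmetrySeries (1 : ℤ → K))) (vac K))) =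
      MvPowerSeries.coeff d (pfaffian (evolvedContraction (K := K) (qHalf K Sum.inr)) l) := by
  refine evolved_word (ψ := phiStar K)
    (ω := fun d => covac K ∘ₗ LinearMap.applyₗ
      (MvPowerSeries.coeff d (formalExp K (-symmetrySeries (1 : ℤ → K))) (vac K)) ∘ₗ
      (opLinearEquiv K).symm.toLinearMap)
    -- In the opposite algebra `x * op (-B)` acts with `-B` last, directly under `⟨0|`, which
    -- annihilates it. This replaces `H_k|0⟩ = 0`.
    (h := Sum.elim (fun _ => 0) fun n => op (-symmetryOp 1 n))
    (c := Sum.elim (fun _ => 0) fun _ => 1)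
    (k := Sum.elim (fun n => n) fun n => n) ?_ ?_ ?_ ?_ (qHalf_neg _) (constantCoeff_qHalf _) ?_ d l
  · rintro (i | i) n
    · simp
    · refine unop_injective ?_
      simpa using phiStar_unop_mul_neg_symmetryOp i n
  · intro d x
    have h := congrArg (fun X => covac K (x.unop (X (vac K))))
      (degree_smul_coeff_formalExp_left (K := K)
        (Sum.elim (fun _ => 0) fun n => -symmetryOp (1 : ℤ → K) n) d)
    simp only [LinearMap.smul_apply, map_smul, LinearMap.sum_apply, map_sum] at h
    rw [← neg_symmetrySeries] at h
    refine h.trans (Finset.sum_congr rfl fun i _ => ?_)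
    rcases i with i | i
    · change covac K (x.unop 0) = covac K ((0 * x).unop _)
      simp
    · rfl
  · rintro d (i | i) x
    · change covac K ((x * 0).unop (MvPowerSeries.coeff d
        (formalExp K (-symmetrySeries (1 : ℤ → K))) (vac K))) = 0
      simp
    · change covac K (-(symmetryOp 1 i (x.unop (MvPowerSeries.coeff d
        (formalExp K (-symmetrySeries (1 : ℤ → K))) (vac K))))) = 0
      rw [map_neg, covac_symmetryOp, neg_zero]
  · intro l
    rw [neg_symmetrySeries, coeff_zero_formalExp_linearSeries]
    exact covac_word_phiStar l
  · rintro (i | i) j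
    · simp [pderiv_qHalf_of_notMem (v := Sum.inr) (i := Sum.inl i) (by simp)]
    · simp [pderiv_qHalf Sum.inr_injective]

end Evolution

end NeutralFermion

namespace NeutralFermion

open SchurQ MulOpposite

variable {K : Type*} [Field K]

/-! ### Removing `r` by a rescaling of the modes -/

section Gauge

/-- The factors `r(1) r(2) ⋯ r(n)`. -/
def gaugeFactor (r : ℤ → K) (n : ℕ) : K := ∏ j ∈ Finset.Icc 1 n, r j

theorem gaugeFactor_zero (r : ℤ → K) : gaugeFactor r 0 = 1 := by simp [gaugeFactor]

theorem gaugeFactor_eq_prod_range (r : ℤ → K) (n : ℕ) :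
    gaugeFactor r n = ∏ i ∈ Finset.range n, r ((i + 1 : ℕ) : ℤ) := by
  rw [gaugeFactor, ← Finset.Ico_add_one_right_eq_Icc, Finset.prod_Ico_eq_prod_range,
    Nat.add_sub_cancel]
  simp only [add_comm 1]

theorem gaugeFactor_mul_prod (r : ℤ → K) (n k : ℕ) :
    gaugeFactor r n * ∏ i ∈ Finset.range k, r ((n : ℤ) + (i + 1 : ℕ)) = gaugeFactor r (n + k) := by
  rw [gaugeFactor_eq_prod_range, gaugeFactor_eq_prod_range, Finset.prod_range_add]
  congr 1

/-- The product runs from `r(a)` down to `r(1-b)`; the factors with argument at most `0` are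
reflected to `r(1), …, r(b)`. -/
theorem prod_range_reflected {r : ℤ → K} (hr : ∀ n, r n = r (1 - n)) (a b : ℕ) :
    ∏ i ∈ Finset.range (a + b), r ((a : ℤ) - i) = gaugeFactor r a * gaugeFactor r b := by
  rw [Finset.prod_range_add, gaugeFactor_eq_prod_range, gaugeFactor_eq_prod_range]
  congr 1
  · rw [← Finset.prod_range_reflect]
    refine Finset.prod_congr rfl fun i hi => ?_
    rw [Finset.mem_range] at hi
    congr 1
    omega
  · refine Finset.prod_congr rfl fun i hi => ?_
    rw [hr]
    congr 1
    push_cast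
    ring

/-- The rescaling `e_n ↦ r(1) ⋯ r(n) e_n` of the creation modes. -/
def gaugeIsometry (r : ℤ → K) : modeForm K →qᵢ modeForm K where
  toLinearMap := Finsupp.linearCombination K fun n => Finsupp.single n (gaugeFactor r n)
  map_app' v := by
    have h : (Finsupp.lapply 0 : Modes K →ₗ[K] K) ∘ₗ
        Finsupp.linearCombination K (fun n => Finsupp.single n (gaugeFactor r n)) =
        Finsupp.lapply 0 := by
      ext n
      by_cases hn : n = 0
      · subst hn; simp [gaugeFactor_zero]
      · simp [hn]
    have h' : (Finsupp.linearCombination K (fun n => Finsupp.single n (gaugeFactor r n)) v) 0 =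
        v 0 := LinearMap.congr_fun h v
    simp [modeForm, h']

/-- The rescaling `φ_{n_1} ⋯ φ_{n_k}|0⟩ ↦ ∏_i r(1) ⋯ r(n_i) φ_{n_1} ⋯ φ_{n_k}|0⟩` of the Fock
space. -/
def gauge (r : ℤ → K) : Fock K →ₗ[K] Fock K := (CliffordAlgebra.map (gaugeIsometry r)).toLinearMap

theorem gauge_vac (r : ℤ → K) : gauge r (vac K) = vac K := map_one (CliffordAlgebra.map _)

theorem gauge_phi (r : ℤ → K) (n : ℕ) (x : Fock K) :
    gauge r (phi K n x) = gaugeFactor r n • phi K n (gauge r x) := by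
  have h : gaugeIsometry r (Finsupp.single n 1) = gaugeFactor r n • Finsupp.single n (1 : K) := by
    change Finsupp.linearCombination K _ _ = _
    simp
  rw [phi_natCast, phi_natCast, gauge, AlgHom.toLinearMap_apply, map_mul,
    CliffordAlgebra.map_apply_ι, h, map_smul, smul_mul_assoc]
  rfl

variable [CharZero K]

/-- Both sides agree on the vacuum, and the commutators with creation modes match because `r(1) ⋯
r(n)` times `r(n+1) ⋯ r(n+k)` is the factor of the mode `n + k`. -/
theorem symmetryOp_gauge {r : ℤ → K} (hr : ∀ n, r n = r (1 - n)) (k : OddIndex) (x : Fock K) :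
    symmetryOp r k (gauge r x) = gauge r (symmetryOp 1 k x) := by
  have hvac : symmetryOp r k (vac K) = gauge r (symmetryOp 1 k (vac K)) := by
    refine Eq.trans ?_ (map_pairSum (gauge r) k.ne_zero _ _).symm
    refine (pairSum_apply k.ne_zero _ _).trans (finsum_congr fun n => ?_)
    -- On the vacuum only the terms with `0 ≤ n ≤ k` survive, and there both factors are creation
    -- modes.
    rcases lt_or_ge n 0 with hn | hn
    · rw [phi_comm_of_ne (by have := k.ne_zero; omega), phi_vac hn]
      simp
    rcases lt_or_ge ((k : ℕ) - n) 0 with hn' | hn'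
    · rw [phi_vac hn']
      simp
    obtain ⟨a, rfl⟩ := Int.eq_ofNat_of_zero_le hn
    obtain ⟨b, hb⟩ := Int.eq_ofNat_of_zero_le hn'
    have hk : (k : ℕ) = a + b := by omega
    rw [hb, map_smul, gauge_phi, gauge_phi, gauge_vac, map_smul, hk, prod_range_reflected hr,
      smul_smul, smul_smul]
    simp [mul_assoc]
  induction x using CliffordAlgebra.left_induction with
  | algebraMap c =>
    have h : algebraMap K (Fock K) c = c • vac K := Algebra.algebraMap_eq_smul_one c
    rw [h, map_smul, map_smul, map_smul, map_smul, gauge_vac, hvac]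
  | add x y hx hy => simp only [map_add, hx, hy]
  | ι_mul x v hx =>
    induction v using Finsupp.induction_linear with
    | zero => simp
    | add f g hf hg => simp only [map_add, add_mul, hf, hg]
    | single n c =>
      have h : Finsupp.single n c = c • Finsupp.single n (1 : K) := by simp
      rw [h, map_smul, smul_mul_assoc]
      simp only [map_smul]
      congr 1
      have hcomm : ∀ (s : ℤ → K), (∀ n, s n = s (1 - n)) → ∀ y : Fock K,
          symmetryOp s k (phi K n y) = phi K n (symmetryOp s k y) -
            (∏ i ∈ Finset.range k, s (n + (i + 1 : ℕ))) • phi K ((n + k : ℕ) : ℤ) y := by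
        intro s hs y
        have h' := congrArg (fun f => f y) (symmetryOp_mul_phi hs k n)
        rw [Nat.cast_add]
        exact h'
      rw [← phi_natCast, gauge_phi, map_smul, hcomm r hr, hcomm 1 fun _ => rfl, hx, map_sub,
        gauge_phi, map_smul, gauge_phi, smul_sub, smul_smul, gaugeFactor_mul_prod]
      simp

/-- The intertwining relation is propagated through the degrees by the left Euler identity. -/
theorem exp_symmetry_vac {r : ℤ → K} (hr : ∀ n, r n = r (1 - n)) (d : Times →₀ ℕ) :
    MvPowerSeries.coeff d (formalExp K (-symmetrySeries r)) (vac K) =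
      gauge r (MvPowerSeries.coeff d (formalExp K (-symmetrySeries (1 : ℤ → K))) (vac K)) := by
  induction hn : d.degree generalizing d with
  | zero =>
    obtain rfl := Finsupp.degree_eq_zero_iff d |>.mp hn
    rw [neg_symmetrySeries, neg_symmetrySeries, coeff_zero_formalExp_linearSeries,
      coeff_zero_formalExp_linearSeries]
    exact (gauge_vac r).symm
  | succ n ih =>
    have hd : (d.degree : K) ≠ 0 := by rw [hn]; exact_mod_cast Nat.succ_ne_zero n
    refine smul_right_injective _ hd ?_
    have hrec : ∀ s : ℤ → K, (d.degree : K) •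
        MvPowerSeries.coeff d (formalExp K (-symmetrySeries s)) (vac K) =
        ∑ i ∈ d.support, (Sum.elim (fun _ => 0) (fun n => -symmetryOp s n) i :
          Module.End K (Fock K)) (MvPowerSeries.coeff (d - Finsupp.single i 1)
            (formalExp K (-symmetrySeries s)) (vac K)) := by
      intro s
      have h := congrArg (fun X => X (vac K)) (degree_smul_coeff_formalExp_left (K := K)
        (Sum.elim (fun _ => 0) fun n => -symmetryOp s n) d)
      simp only [LinearMap.smul_apply, LinearMap.sum_apply] at h
      rw [neg_symmetrySeries]
      exact h
    simp only [← map_smul (gauge r)]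
    rw [hrec, hrec, map_sum]
    refine Finset.sum_congr rfl fun i hi => ?_
    have hdeg := degree_sub_single hi
    rw [ih _ (by omega)]
    rcases i with i | i
    · simp
    · simp only [Sum.elim_inr, LinearMap.neg_apply, map_neg, symmetryOp_gauge hr]

end Gauge

/-! ### The orthogonal basis of decreasing words -/

section Basis

/-- The vector `φ_{n_1} ⋯ φ_{n_k}|0⟩`. -/
def wordVec (K : Type*) [Field K] (l : List ℕ) : Fock K :=
  word (phi K) (l.map Nat.cast) (vac K)

theorem wordVec_cons (n : ℕ) (l : List ℕ) :
    wordVec K (n :: l) = phi K n (wordVec K l) := by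
  rw [wordVec, List.map_cons, word_cons]
  rfl

theorem gauge_wordVec (r : ℤ → K) (l : List ℕ) :
    gauge r (wordVec K l) = (l.map (gaugeFactor r)).prod • wordVec K l := by
  induction l with
  | nil => simpa [wordVec, word_nil] using gauge_vac r
  | cons n l ih =>
    rw [wordVec_cons, gauge_phi, ih, map_smul, smul_smul, List.map_cons, List.prod_cons]

/-- The functional `⟨0| φ_{n_k}^* ⋯ φ_{n_1}^*`. -/
def wordDual (K : Type*) [Field K] (l : List ℕ) : Fock K →ₗ[K] K :=
  covac K ∘ₗ (word (phiStar K) (l.map Nat.cast)).unop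

theorem wordDual_cons (n : ℕ) (l : List ℕ) (x : Fock K) :
    wordDual K (n :: l) x = (-1) ^ n * wordDual K l (phi K (-n) x) := by
  have h : wordDual K (n :: l) x = wordDual K l ((-1 : K) ^ n • phi K (-n) x) := by
    rw [wordDual, List.map_cons, word_cons, unop_mul]
    rfl
  rw [h, map_smul, smul_eq_mul]

/-- The span of the basis vectors whose modes are below `b`. -/
def wordSpan (K : Type*) [Field K] (b : ℕ) : Submodule K (Fock K) :=
  Submodule.span K (wordVec K '' {l | l.Pairwise (· > ·) ∧ ∀ n ∈ l, n < b})

theorem wordVec_mem_wordSpan {b : ℕ} {l : List ℕ} (hl : l.Pairwise (· > ·))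
    (h : ∀ n ∈ l, n < b) : wordVec K l ∈ wordSpan K b :=
  Submodule.subset_span ⟨l, ⟨hl, h⟩, rfl⟩

theorem phi_mem_wordSpan_of_lt {b c : ℕ} (hc : c < b) {x : Fock K} (hx : x ∈ wordSpan K c) :
    phi K c x ∈ wordSpan K b := by
  have h : wordSpan K c ≤ (wordSpan K b).comap (phi K c) := by
    rw [wordSpan, Submodule.span_le]
    rintro _ ⟨l, ⟨hl, hlc⟩, rfl⟩
    change phi K c (wordVec K l) ∈ wordSpan K b
    rw [← wordVec_cons]
    refine wordVec_mem_wordSpan (List.pairwise_cons.mpr ⟨hlc, hl⟩) fun n hn => ?_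
    rcases List.mem_cons.mp hn with rfl | hn
    · exact hc
    · exact (hlc n hn).trans hc
  exact h hx

variable [CharZero K]

theorem phi_neg_wordVec {a : ℕ} {l : List ℕ} (ha : 0 < a) (h : ∀ n ∈ l, n < a) :
    phi K (-a) (wordVec K l) = 0 := by
  induction l with
  | nil => exact phi_vac (by omega)
  | cons n l ih =>
    have := h n (by simp)
    rw [wordVec_cons, phi_comm_of_ne (by omega), ih fun m hm => h m (by simp [hm]), map_zero,
      neg_zero]

theorem wordDual_phi {b : ℕ} {l : List ℕ} (hb : 0 < b) (h : ∀ n ∈ l, n < b) (x : Fock K) :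
    wordDual K l (phi K b x) = 0 := by
  induction l generalizing x with
  | nil => exact covac_phi (by omega) x
  | cons n l ih =>
    have := h n (by simp)
    rw [wordDual_cons, phi_comm_of_ne (by omega), map_neg, ih fun m hm => h m (by simp [hm]),
      neg_zero, mul_zero]

theorem phi_zero_phi_zero (x : Fock K) : phi K 0 (phi K 0 x) = (1 / 2 : K) • x := by
  have h := congrArg (fun f => f x) (isNeutral_phi K 0 0)
  have h' : phi K 0 (phi K 0 x) + phi K 0 (phi K 0 x) = x := by simpa using h
  rw [← two_smul K] at h'
  conv_rhs => rw [← h', smul_smul]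
  norm_num

theorem phi_phi_self {n : ℕ} (hn : 0 < n) (x : Fock K) : phi K n (phi K n x) = 0 := by
  have h := phi_comm_of_ne (K := K) (m := n) (n := n) (by omega) x
  have h' : (2 : K) • phi K n (phi K n x) = 0 := by
    rw [two_smul]
    exact add_eq_zero_iff_eq_neg.mpr h
  exact (smul_eq_zero.mp h').resolve_left two_ne_zero

/-- The squared norms of the basis vectors. -/
def wordNorm (K : Type*) [Field K] (l : List ℕ) : K := if 0 ∈ l then 1 / 2 else 1

theorem eq_nil_of_forall_lt_zero {l : List ℕ} (h : ∀ n ∈ l, n < 0) : l = [] :=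
  List.eq_nil_iff_forall_not_mem.mpr fun n hn => (Nat.not_lt_zero n) (h n hn)

/-- Compare the leading letters. If they differ, the larger one occurs in no other place, so its
operator passes through all other letters and kills a vacuum. If they agree, they are stripped off
together; a common leading letter `0` means that both words are `[0]`, and `φ_0 ^ 2 = 1/2`. -/
theorem wordDual_wordVec {l m : List ℕ} (hl : l.Pairwise (· > ·)) (hm : m.Pairwise (· > ·)) :
    wordDual K l (wordVec K m) = if l = m then wordNorm K l else 0 := by
  induction l generalizing m with
  | nil =>
    cases m with
    | nil =>
      have h : wordDual K [] (wordVec K []) = 1 := covac_vac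
      simpa [wordNorm] using h
    | cons b m =>
      rw [if_neg (by simp), wordVec_cons]
      rcases Nat.eq_zero_or_pos b with rfl | hb
      · obtain rfl := eq_nil_of_forall_lt_zero (List.pairwise_cons.mp hm).1
        exact covac_phi_zero_vac
      · exact covac_phi (by omega) _
  | cons a l ih =>
    have hl' := List.pairwise_cons.mp hl
    cases m with
    | nil =>
      rw [if_neg (by simp), wordDual_cons]
      rcases Nat.eq_zero_or_pos a with rfl | ha
      · obtain rfl := eq_nil_of_forall_lt_zero hl'.1
        have : wordDual K [] (phi K (-(0 : ℕ)) (wordVec K [])) = 0 := covac_phi_zero_vac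
        rw [this, mul_zero]
      · rw [phi_neg_wordVec ha (by simp), map_zero, mul_zero]
    | cons b m =>
      have hm' := List.pairwise_cons.mp hm
      rcases lt_trichotomy a b with h | h | h
      · rw [if_neg (by simp [h.ne]), wordVec_cons, wordDual_phi (by omega)]
        intro n hn
        rcases List.mem_cons.mp hn with rfl | hn
        · exact h
        · exact (hl'.1 n hn).trans h
      · subst h
        rcases Nat.eq_zero_or_pos a with rfl | ha
        · obtain rfl := eq_nil_of_forall_lt_zero hl'.1
          obtain rfl := eq_nil_of_forall_lt_zero hm'.1
          have h1 : phi K (-(0 : ℕ)) (wordVec K [0]) = (1 / 2 : K) • vac K :=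
            phi_zero_phi_zero (vac K)
          have h2 : wordDual K [] (vac K) = 1 := covac_vac
          rw [if_pos rfl, wordDual_cons, h1, map_smul, h2]
          simp [wordNorm]
        · have h1 : phi K (-a) (phi K a (wordVec K m)) = (-1 : K) ^ a • wordVec K m := by
            have h := congrArg (fun f => f (wordVec K m)) (isNeutral_phi K (-a) a)
            have h' : phi K (-a) (phi K a (wordVec K m)) +
                phi K a (phi K (-a) (wordVec K m)) = (-1 : K) ^ a • wordVec K m := by
              simpa using h
            rwa [phi_neg_wordVec ha hm'.1, map_zero, add_zero] at h'
          rw [wordDual_cons, wordVec_cons, h1, map_smul, ih hl'.2 hm'.2, smul_eq_mul, ← mul_assoc,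
            ← mul_pow]
          simp [wordNorm, ha.ne]
      · rw [if_neg (by simp [h.ne']), wordDual_cons, phi_neg_wordVec (by omega), map_zero, mul_zero]
        intro n hn
        rcases List.mem_cons.mp hn with rfl | hn
        · exact h
        · exact (hm'.1 n hn).trans h

/-- Insert `n` at its place. The bound on the modes is what makes the induction close: once `n` has
been moved past a larger leading letter `c`, the rest lies in the span of modes below `c`, so `c`
can be put back in front. -/
theorem phi_wordVec_mem_wordSpan {n b : ℕ} (hn : n < b) {l : List ℕ} (hl : l.Pairwise (· > ·))
    (h : ∀ m ∈ l, m < b) : phi K n (wordVec K l) ∈ wordSpan K b := by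
  induction l generalizing b with
  | nil =>
    rw [← wordVec_cons]
    exact wordVec_mem_wordSpan (List.pairwise_singleton _ _) (by simpa using hn)
  | cons c l ih =>
    have hl' := List.pairwise_cons.mp hl
    have hlb : ∀ m ∈ l, m < b := fun m hm => h m (by simp [hm])
    rcases lt_trichotomy n c with hc | rfl | hc
    · rw [wordVec_cons, phi_comm_of_ne (by omega)]
      exact Submodule.neg_mem _ (phi_mem_wordSpan_of_lt (h c (by simp)) (ih hc hl'.2 hl'.1))
    · rw [wordVec_cons]
      rcases Nat.eq_zero_or_pos n with rfl | hn0
      · rw [Nat.cast_zero, phi_zero_phi_zero]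
        exact Submodule.smul_mem _ _ (wordVec_mem_wordSpan hl'.2 hlb)
      · rw [phi_phi_self hn0]
        exact Submodule.zero_mem _
    · rw [← wordVec_cons]
      refine wordVec_mem_wordSpan (List.pairwise_cons.mpr ⟨fun m hm => ?_, hl⟩) fun m hm => ?_
      · rcases List.mem_cons.mp hm with rfl | hm
        · exact hc
        · exact (hl'.1 m hm).trans hc
      · rcases List.mem_cons.mp hm with rfl | hm
        · exact hn
        · exact h m hm

theorem phi_mem_wordSpan {n b : ℕ} (hn : n < b) {x : Fock K} (hx : x ∈ wordSpan K b) :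
    phi K n x ∈ wordSpan K b := by
  have h : wordSpan K b ≤ (wordSpan K b).comap (phi K n) := by
    conv_lhs => rw [wordSpan]
    rw [Submodule.span_le]
    rintro _ ⟨l, ⟨hl, hlb⟩, rfl⟩
    exact phi_wordVec_mem_wordSpan hn hl hlb
  exact h hx

theorem span_wordVec :
    Submodule.span K (wordVec K '' {l | l.Pairwise (· > ·)}) = ⊤ := by
  rw [eq_top_iff, ← span_phi_vac, Submodule.span_le]
  rintro _ ⟨l, rfl⟩
  have hw : ∀ b (m : List ℕ), (∀ n ∈ m, n < b) → wordVec K m ∈ wordSpan K b := by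
    intro b m
    induction m with
    | nil => exact fun h => wordVec_mem_wordSpan List.Pairwise.nil h
    | cons n m ih =>
      intro h
      rw [wordVec_cons]
      exact phi_mem_wordSpan (h n (by simp)) (ih fun k hk => h k (by simp [hk]))
  have hle : wordSpan K (l.sum + 1) ≤
      Submodule.span K (wordVec K '' {l | l.Pairwise (· > ·)}) :=
    Submodule.span_mono (Set.image_mono fun _ h => h.1)
  -- In `span_phi_vac` the list is coerced to integers as a whole, through a monadic bind, before
  -- `phi` is mapped over it.
  have h1 : (l >>= fun a => pure (a : ℤ)) = l.map Nat.cast := bind_pure_comp _ _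
  have h2 : ((l >>= fun a => pure (a : ℤ)).map fun n => phi K n).prod (vac K) = wordVec K l := by
    rw [h1]
    rfl
  change ((l >>= fun a => pure (a : ℤ)).map fun n => phi K n).prod (vac K) ∈ _
  rw [h2]
  exact hle (hw _ _ fun n hn => Nat.lt_succ_of_le (List.le_sum_of_mem hn))

/-- The strictly decreasing words in the creation modes, which index the basis of Fock space. -/
abbrev DecreasingWord : Type := {l : List ℕ // l.Pairwise (· > ·)}

/-- Orthogonality identifies the coefficients of an expansion in the spanning words, so the words
form a basis with explicit coordinates. -/
theorem exists_expansion (x : Fock K) : ∃ F : Finset DecreasingWord,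
    (∀ l ∉ F, wordDual K l x = 0) ∧
    x = ∑ l ∈ F, ((wordNorm K l)⁻¹ * wordDual K l x) • wordVec K l := by
  classical
  -- Allowing every larger index set lets the expansions of two vectors be added over the union.
  suffices h : ∃ F : Finset DecreasingWord, (∀ l ∉ F, wordDual K l x = 0) ∧ ∀ G, F ⊆ G →
      x = ∑ l ∈ G, ((wordNorm K l)⁻¹ * wordDual K l x) • wordVec K l by
    obtain ⟨F, h1, h2⟩ := h
    exact ⟨F, h1, h2 F subset_rfl⟩
  have hx : x ∈ Submodule.span K (wordVec K '' {l | l.Pairwise (· > ·)}) := by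
    rw [span_wordVec]; trivial
  induction hx using Submodule.span_induction with
  | mem y hy =>
    obtain ⟨l, hl, rfl⟩ := hy
    refine ⟨{⟨l, hl⟩}, fun m hm => ?_, fun G hG => ?_⟩
    · rw [wordDual_wordVec m.2 hl, if_neg]
      intro h
      exact hm (Finset.mem_singleton.mpr (Subtype.ext h))
    · rw [Finset.sum_eq_single ⟨l, hl⟩]
      · have h0 : wordNorm K l ≠ 0 := by rw [wordNorm]; split_ifs <;> norm_num
        rw [wordDual_wordVec hl hl, if_pos rfl, inv_mul_cancel₀ h0, one_smul]
      · intro m _ hm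
        rw [wordDual_wordVec m.2 hl, if_neg fun h => hm (Subtype.ext h), mul_zero, zero_smul]
      · intro h
        exact absurd (hG (Finset.mem_singleton_self _)) h
  | zero => exact ⟨∅, by simp, by simp⟩
  | add y z _ _ hy hz =>
    obtain ⟨F, hF1, hF2⟩ := hy
    obtain ⟨G, hG1, hG2⟩ := hz
    refine ⟨F ∪ G, fun l hl => ?_, fun H hH => ?_⟩
    · rw [Finset.mem_union, not_or] at hl
      rw [map_add, hF1 l hl.1, hG1 l hl.2, add_zero]
    · conv_lhs => rw [hF2 H (Finset.union_subset_left hH), hG2 H (Finset.union_subset_right hH)]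
      rw [← Finset.sum_add_distrib]
      simp only [map_add, mul_add, add_smul]
  | smul c y _ hy =>
    obtain ⟨F, hF1, hF2⟩ := hy
    refine ⟨F, fun l hl => by rw [map_smul, hF1 l hl, smul_zero], fun H hH => ?_⟩
    conv_lhs => rw [hF2 H hH, Finset.smul_sum]
    refine Finset.sum_congr rfl fun l _ => ?_
    rw [map_smul, smul_smul, smul_eq_mul]
    congr 1
    ring

end Basis

/-! ### The tau function as a sum over decreasing words -/

section Expansion

variable [CharZero K]

/-- The contribution of a decreasing word to the tau function. -/
def wordTerm (r : ℤ → K) (l : List ℕ) : MvPowerSeries Times K :=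
  ((wordNorm K l)⁻¹ * (l.map (gaugeFactor r)).prod) •
    (pfaffian (evolvedContraction (K := K) (qHalf K Sum.inl)) (l.map Nat.cast) *
      pfaffian (evolvedContraction (K := K) (qHalf K Sum.inr)) (l.map Nat.cast))

/-- For each splitting of `d` between the two exponentials, the vector produced by the right one is
a finite combination of basis words; there are finitely many splittings, so finitely many words
matter. -/
theorem coeff_tau_eq_sum {r : ℤ → K} (hr : ∀ n, r n = r (1 - n)) (d : Times →₀ ℕ) :
    ∃ F : Finset DecreasingWord,
      (∀ l ∉ F, MvPowerSeries.coeff d (wordTerm r l) = 0) ∧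
      MvPowerSeries.coeff d (tau r) = ∑ l ∈ F, MvPowerSeries.coeff d (wordTerm r l) := by
  classical
  set x : (Times →₀ ℕ) → Fock K := fun v =>
    MvPowerSeries.coeff v (formalExp K (-symmetrySeries (1 : ℤ → K))) (vac K) with hx
  choose F hF1 hF2 using fun v => exists_expansion (x v)
  have hdual : ∀ (v : Times →₀ ℕ) (l : List ℕ), wordDual K l (x v) = MvPowerSeries.coeff v
      (pfaffian (evolvedContraction (K := K) (qHalf K Sum.inr)) (l.map Nat.cast)) :=
    fun v l => covac_word_phiStar_exp_symmetry v _
  have hterm : ∀ l : List ℕ, MvPowerSeries.coeff d (wordTerm r l) =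
      ∑ u ∈ Finset.HasAntidiagonal.antidiagonal d,
        (wordNorm K l)⁻¹ * (l.map (gaugeFactor r)).prod * (MvPowerSeries.coeff u.1
          (pfaffian (evolvedContraction (K := K) (qHalf K Sum.inl)) (l.map Nat.cast)) *
          wordDual K l (x u.2)) := by
    intro l
    simp only [hdual]
    rw [wordTerm, MvPowerSeries.coeff_smul, MvPowerSeries.coeff_mul, Finset.mul_sum]
  set G := (Finset.HasAntidiagonal.antidiagonal d).biUnion fun u => F u.2 with hG
  refine ⟨G, fun l hl => ?_, ?_⟩
  · rw [hterm]
    refine Finset.sum_eq_zero fun u hu => ?_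
    rw [hF1 u.2 l fun h => hl (Finset.mem_biUnion.mpr ⟨u, hu, h⟩), mul_zero, mul_zero]
  · have htau : MvPowerSeries.coeff d (tau r) = covac K (MvPowerSeries.coeff d
        (formalExp K (hamiltonianSeries K) * formalExp K (-symmetrySeries r)) (vac K)) := rfl
    simp only [hterm]
    rw [htau, MvPowerSeries.coeff_mul, LinearMap.sum_apply, map_sum, Finset.sum_comm]
    refine Finset.sum_congr rfl fun u hu => ?_
    -- The vector is expanded for `r = 1`; the rescaling is diagonal on words and supplies the
    -- factor in `r`.
    rw [Module.End.mul_apply, exp_symmetry_vac hr]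
    change covac K (MvPowerSeries.coeff u.1 (formalExp K (hamiltonianSeries K))
      (gauge r (x u.2))) = _
    have hsub : F u.2 ⊆ G := fun l hl => Finset.mem_biUnion.mpr ⟨u, hu, hl⟩
    rw [← Finset.sum_subset hsub fun l _ hl => by rw [hF1 u.2 l hl, mul_zero, mul_zero]]
    conv_lhs => rw [hF2 u.2]
    simp only [map_sum, map_smul, gauge_wordVec]
    refine Finset.sum_congr rfl fun l _ => ?_
    rw [← covac_exp_hamiltonian_word, ← wordVec, smul_eq_mul, smul_eq_mul]
    ring

theorem hasSum_wordTerm [TopologicalSpace K] {r : ℤ → K} (hr : ∀ n, r n = r (1 - n)) :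
    HasSum (fun l : DecreasingWord => wordTerm r l) (tau r) := by
  rw [MvPowerSeries.WithPiTopology.hasSum_iff_hasSum_coeff]
  intro d
  obtain ⟨F, hF1, hF2⟩ := coeff_tau_eq_sum hr d
  rw [hF2]
  exact hasSum_sum_of_ne_finset_zero hF1

end Expansion

end NeutralFermion

/-! ### From decreasing words to strict partitions -/

namespace SchurQ

open NeutralFermion

theorem rowExp_map {ι κ R M : Type*} [CommRing R] [AddCommGroup M] [Module R M] (f : κ → ι)
    (b : ι → R) (F : List ι → M) (l : List κ) :
    rowExp b F (l.map f) = rowExp (fun x => b (f x)) (fun m => F (m.map f)) l := by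
  induction l generalizing F with
  | nil => rfl
  | cons y ys ih => simp only [List.map_cons, rowExp, ih]

theorem pfaffian_map {ι κ R : Type*} [CommRing R] (f : κ → ι) (a : ι → ι → R) (l : List κ) :
    pfaffian a (l.map f) = pfaffian (fun x y => a (f x) (f y)) l := by
  induction h : l.length using Nat.strong_induction_on generalizing l with
  | _ n ih =>
    cases l with
    | nil => simp [pfaffian_nil]
    | cons x xs =>
      rw [List.map_cons, pfaffian_cons, pfaffian_cons, rowExp_map]
      refine rowExp_congr_fun fun m hm => ih m.length ?_ m rfl
      simp only [List.length_cons] at h; omega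

/-- The decreasing word of even length belonging to a strict partition. -/
def StrictPartition.toWord (p : StrictPartition) : DecreasingWord :=
  ⟨if Even p.length then p.parts else p.parts ++ [0], by
    split_ifs
    · exact p.decreasing
    · exact List.pairwise_append.mpr ⟨p.decreasing, List.pairwise_singleton _ _,
        fun a ha b hb => by rw [List.mem_singleton.mp hb]; exact p.pos a ha⟩⟩

theorem StrictPartition.zero_notMem (p : StrictPartition) : 0 ∉ p.parts :=
  fun h => lt_irrefl _ (p.pos 0 h)

theorem StrictPartition.filter_toWord (p : StrictPartition) :
    p.toWord.1.filter (0 < ·) = p.parts := by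
  have h : p.parts.filter (0 < ·) = p.parts :=
    List.filter_eq_self.mpr fun n hn => by simpa using p.pos n hn
  rw [toWord]
  split_ifs
  · exact h
  · rw [List.filter_append, h]
    simp

theorem StrictPartition.toWord_injective : Function.Injective StrictPartition.toWord := by
  intro p p' h
  have h' : p.parts = p'.parts := by rw [← p.filter_toWord, h, p'.filter_toWord]
  cases p
  cases p'
  congr

/-- A mode `0` can only be the last letter of a decreasing word, so dropping it leaves a strict
partition, of odd length when the word has even length. -/
theorem exists_toWord_eq {l : DecreasingWord} (hl : Even l.1.length) :
    ∃ p : StrictPartition, p.toWord = l := by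
  obtain ⟨l, hd⟩ := l
  by_cases h : 0 ∈ l
  · obtain ⟨m, m', rfl⟩ := List.append_of_mem h
    have hd' := List.pairwise_append.mp hd
    obtain rfl : m' = [] := eq_nil_of_forall_lt_zero (List.pairwise_cons.mp hd'.2.1).1
    refine ⟨⟨m, hd'.1, fun n hn => hd'.2.2 n hn 0 (by simp)⟩, Subtype.ext ?_⟩
    change (if Even m.length then m else m ++ [0]) = m ++ [0]
    rw [if_neg]
    rw [Nat.even_iff] at hl ⊢
    simp only [List.length_append, List.length_singleton] at hl
    omega
  · refine ⟨⟨l, hd, fun n hn => Nat.pos_of_ne_zero fun h0 => h (h0 ▸ hn)⟩, Subtype.ext ?_⟩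
    exact if_pos hl

variable {K : Type*} [Field K]

theorem StrictPartition.rProd_eq (r : ℤ → K) (p : StrictPartition) :
    p.rProd r = (p.parts.map (gaugeFactor r)).prod := by
  have h : ∀ n : ℕ, ∏ j ∈ Finset.Icc (1 : ℤ) n, r j = gaugeFactor r n := by
    intro n
    refine (Finset.prod_nbij (fun i : ℕ => (i : ℤ)) (fun i hi => ?_) (fun a _ b _ h => ?_)
      (fun j hj => ?_) fun _ _ => rfl).symm
    · rw [Finset.mem_Icc] at hi ⊢
      omega
    · exact Nat.cast_injective h
    · rw [Finset.mem_coe, Finset.mem_Icc] at hj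
      refine ⟨j.toNat, ?_, by simp; omega⟩
      rw [Finset.mem_coe, Finset.mem_Icc]
      omega
  have h2 : (p.parts >>= fun a => pure (a : ℤ)) = p.parts.map Nat.cast := bind_pure_comp _ _
  change ((p.parts >>= fun a => pure (a : ℤ)).map fun n => ∏ j ∈ Finset.Icc 1 n, r j).prod = _
  rw [h2, List.map_map]
  congr 1
  exact List.map_congr_left fun n _ => h n

theorem wordTerm_eq_zero_of_odd (r : ℤ → K) {l : List ℕ} (hl : Odd l.length) :
    wordTerm r l = 0 := by
  rw [wordTerm, pfaffian_eq_zero_of_odd _ _ (by simpa using hl), zero_mul, smul_zero]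

theorem wordTerm_nil (r : ℤ → K) : wordTerm r [] = 1 := by
  simp [wordTerm, wordNorm, pfaffian_nil]

variable [CharZero K]

theorem pfaffian_evolvedContraction_qHalf (v : OddIndex → Times) {l : List ℕ} {n : ℕ}
    (hl : l.length = 2 * n) :
    pfaffian (evolvedContraction (K := K) (qHalf K v)) (l.map Nat.cast) =
      (1 / 2 : K) ^ n • halfTimes K v (pfaffian (Q2 K) l) := by
  have h : (fun a b : ℕ => evolvedContraction (K := K) (qHalf K v) a b) =
      fun a b => (halfTimes K v).toRingHom (MvPolynomial.C (1 / 2) * Q2 K a b) :=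
    funext fun a => funext fun b => evolvedContraction_qHalf v a b
  rw [pfaffian_map, h, ← ringHom_pfaffian, pfaffian_smul _ _ n l hl, ← map_pow,
    ← MvPolynomial.smul_eq_C_mul]
  exact map_smul (halfTimes K v) _ _

/-- For a word of length `2n` each Pfaffian contributes `2^{-n}`. If `l(λ)` is even, `2n = l(λ)` and
the norm is `1`; if it is odd, `2n = l(λ) + 1` and the appended `0` has inverse norm `2`. Both cases
give `2^{-l(λ)}`, and the appended `0` has gauge factor `1`. -/
theorem wordTerm_toWord (r : ℤ → K) (p : StrictPartition) :
    wordTerm r p.toWord = tauTerm K r p := by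
  have key : ∀ n, p.toWord.1.length = 2 * n →
      (wordNorm K p.toWord.1)⁻¹ * (1 / 2 : K) ^ (2 * n) = 2⁻¹ ^ p.length →
      (p.toWord.1.map (gaugeFactor r)).prod = p.rProd r →
      wordTerm r p.toWord = tauTerm K r p := by
    intro n hn hnorm hprod
    rw [wordTerm, pfaffian_evolvedContraction_qHalf _ hn, pfaffian_evolvedContraction_qHalf _ hn,
      hprod, smul_mul_smul_comm, smul_smul, tauTerm, ← hnorm, two_mul, pow_add]
    congr 1
    ring
  rcases Nat.even_or_odd p.length with he | ho
  · have hw : p.toWord.1 = p.parts := if_pos he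
    obtain ⟨n, hn⟩ := he
    rw [← two_mul] at hn
    refine key n (by rw [hw]; exact hn) ?_ ?_
    · rw [hw, wordNorm, if_neg p.zero_notMem, hn]
      simp
    · rw [hw, p.rProd_eq]
  · have hw : p.toWord.1 = p.parts ++ [0] := if_neg (Nat.not_even_iff_odd.mpr ho)
    obtain ⟨n, hn⟩ := ho
    have hn' : p.parts.length = 2 * n + 1 := hn
    refine key (n + 1) ?_ ?_ ?_
    · rw [hw, List.length_append, hn', List.length_singleton]
      ring
    · rw [hw, wordNorm, if_pos (by simp), hn,
        show 2 * (n + 1) = 2 * n + 1 + 1 by ring, pow_succ _ (2 * n + 1)]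
      simp
      ring
    · rw [hw, List.map_append, List.prod_append, p.rProd_eq]
      simp [gaugeFactor_zero]

/-- The empty word accounts for the subtracted `1`. A nonempty word outside the image of the nonzero
strict partitions has odd length, so its term vanishes. -/
theorem hasSum_tauTerm [TopologicalSpace K] [IsTopologicalRing K] {r : ℤ → K}
    (hr : ∀ n, r n = r (1 - n)) :
    HasSum (fun p : {p : StrictPartition // p.parts ≠ []} => tauTerm K r p) (tau r - 1) := by
  classical
  have h := hasSum_ite_sub_hasSum (α := MvPowerSeries Times K) (β := DecreasingWord)
    (f := fun l => wordTerm r l.1) (a := tau r) (hasSum_wordTerm hr) ⟨[], List.Pairwise.nil⟩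
  simp only [wordTerm_nil] at h
  have hne : ∀ p : StrictPartition, p.parts ≠ [] → p.toWord ≠ ⟨[], List.Pairwise.nil⟩ := by
    intro p hp h
    refine hp ?_
    rw [← p.filter_toWord, h, List.filter_nil]
  have hinj : Function.Injective fun p : {p : StrictPartition // p.parts ≠ []} => p.1.toWord :=
    StrictPartition.toWord_injective.comp Subtype.val_injective
  have hcomp : (fun l : DecreasingWord => if l = ⟨[], List.Pairwise.nil⟩ then 0
      else wordTerm r l) ∘ (fun p : {p : StrictPartition // p.parts ≠ []} => p.1.toWord) =
      fun p : {p : StrictPartition // p.parts ≠ []} => tauTerm K r p :=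
    funext fun p : {p : StrictPartition // p.parts ≠ []} =>
      (if_neg (hne p.1 p.2)).trans (wordTerm_toWord r p.1)
  rw [← hcomp]
  refine (hinj.hasSum_iff fun l hl => ?_).mpr h
  by_cases hle : l = ⟨[], List.Pairwise.nil⟩
  · exact if_pos hle
  · refine (if_neg hle).trans ?_
    rcases Nat.even_or_odd l.1.length with hev | hodd
    · obtain ⟨p, rfl⟩ := exists_toWord_eq hev
      refine absurd ⟨⟨p, fun hp => hle ?_⟩, rfl⟩ hl
      have h0 : Even p.length := by simp [StrictPartition.length, hp]
      exact Subtype.ext ((if_pos h0).trans hp)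
    · exact wordTerm_eq_zero_of_odd r hodd

end SchurQ

end

theorem proposition1 {K : Type*} [Field K] [CharZero K] (r : ℤ → K)
    (hr : ∀ n : ℤ, r n = r (1 - n)) :
    letI : TopologicalSpace K := ⊥
    Summable (fun p : {p : SchurQ.StrictPartition // p.parts ≠ []} => SchurQ.tauTerm K r p) ∧
      NeutralFermion.tau r =
        1 + ∑' p : {p : SchurQ.StrictPartition // p.parts ≠ []}, SchurQ.tauTerm K r p := by
  -- In the discrete topology a convergent sum has only finitely many nonzero terms, so
  -- coefficientwise summability is exactly the finiteness claimed.
  let _ : TopologicalSpace K := ⊥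
  have : DiscreteTopology K := ⟨rfl⟩
  have h := SchurQ.hasSum_tauTerm hr
  exact ⟨h.summable, by rw [h.tsum_eq, add_sub_cancel]⟩
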